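/- **Definitions.** A *weight* on a finite-dimensional real vector space $V$ is a function $\varpi\colon V\to\mathbb R\cup\{-\infty\}$ with $\varpi(v)=-\infty$ iff $v=0$, $\varpi(cv)=\varpi(v)$ for $c\neq 0$, and $\varpi(v+w)\le\max\{\varpi(v),\varpi(w)\}$. The multiplicity of $a\in\mathbb R$ is $\dim\bigl(\{\varpi\le a\}/\{\varpi<a\}\bigr)$; two weights are *compatible* if they take the same finite values with the same multiplicities. For $f\colon V\to W$ smooth near $0$, put $\widetilde D^kf=\frac1{k!}D^k_0f$ (so $\widetilde D^0f=f(0)$). A polynomial map $f\colon V\to W$ between spaces with weights is *subresonant* if for all $k\ge0$ and all nonzero $v_1,\dots,v_k\in V$, $$\varpi_W\bigl(\widetilde D^kf(v_1,\dots,v_k)\bigr)\le\sum_{i=1}^k\varpi_V(v_i),$$ and *invertible subresonant* if moreover $D_0f$ is invertible. For normed spaces, $\|f\|_P=\sum_k\|\widetilde D^kf\|$ (operator norms of multilinear maps). For real $r>0$, $C^r$ means $C^{\lfloor r\rfloor}$ with, when $r\notin\mathbb Z$, derivative of order $\lfloor r\rfloor$ locally $(r-\lfloor r\rfloor)$-Hölder;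 the $C^r$ norm on an open set is the supremum of the norms of all derivatives of order $\le\lfloor r\rfloor$, plus, when $r\notin\mathbb Z$, the $(r-\lfloor r\rfloor)$-Hölder seminorm of the derivative of order $\lfloor r\rfloor$. Write $f_0^{(n)}=f_{n-1}\circ\dots\circ f_0$ and $f_0^{(0)}=\mathrm{id}$. **Setting.** Let $(V^j)_{j\ge0}$ and $(W^j)_{j\ge0}$ be finite-dimensional real normed spaces equipped with weights (all denoted $\varpi$), those on the $V^j$ pairwise compatible with values $\lambda_1<\dots<\lambda_\ell<0$, and those on the $W^j$ pairwise compatible with values $\eta_1<\dots<\eta_p<0$ ($\ell,p\ge1$). Set $d_1=\lfloor\lambda_1/\lambda_\ell\rfloor$, $d_2=\lfloor\lambda_1/\eta_p\rfloor$, $d_3=\lfloor\eta_1/\eta_p\rfloor$, $d=\max\{d_1,d_2,d_3\}$. Fix a real number $r>\lambda_1/\eta_p$, let $s=\min\{r,d_2+1\}$, and let $$\epsilon_0=\frac1{10d}\min\Bigl(\{1,-\lambda_\ell,-\eta_p\}\cup\bigl\{\lambda_i-(\eta_{j_1}+\dots+\eta_{j_k}) : 1\le k\le d_2,\ \lambda_i>\eta_{j_1}+\dots+\eta_{j_k}\bigr\}\Bigr).$$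 Fix $0<\epsilon<\min\Bigl\{\epsilon_0,\dfrac{\lambda_1-s\,\eta_p}{3s+2}\Bigr\}$; the right-hand side is positive. **Proposition 2.5.** For every $j\ge0$ let $f_j\colon V^j\to V^{j+1}$ and $g_j\colon W^j\to W^{j+1}$ be invertible subresonant polynomial maps with $f_j(0)=0$ and $g_j(0)=0$. Suppose there is a constant $C$ such that: 1. $\|D_0f_jv\|\le e^{\varpi(v)+\epsilon}\|v\|$ and $\|D_0g_jw\|\le e^{\varpi(w)+\epsilon}\|w\|$ for all $j$ and all nonzero $v\in V^j$, $w\in W^j$; 2. $\|f_j\|_P\le Ce^{\epsilon j}$ and $\|g_j\|_P\le Ce^{\epsilon j}$ for all $j$; 3. for every nonzero $v\in V^0$ there is $n_0(v)$ such that $e^{n(\varpi(v)-\epsilon)}\|v\|\le\|D_0f_0^{(n)}v\|$ for all $n\ge n_0(v)$. Let $\rho>0$, let $W^n(\rho)$ be the open ball of radius $\rho$ about $0$ in $W^n$, and for every $n\ge0$ let $\phi_n\colon W^n(\rho)\to V^n$ be a $C^r$ function. Suppose: 4. $f_0^{(n)}(\phi_0(x))=\phi_n(g_0^{(n)}(x))$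 for every $n$ and every $x\in W^0(\rho)$ with $g_0^{(n)}(x)\in W^n(\rho)$; 5. $\sup_{n\in S}\|\phi_n\|_{C^r}<\infty$ for some infinite set $S\subset\mathbb N$. Then there is a subresonant polynomial map $h\colon W^0\to V^0$ with $\phi_0(x)=h(x)$ for every $x\in W^0(\rho)$. -/

import Mathlib

open Set Filter Topology
open scoped ENNReal NNReal

noncomputable section

namespace Subres

/-! ### Weights -/

/-- A weight on a real vector space: a function with values in `ℝ ∪ {-∞}` which is `-∞` exactly
at `0`, invariant under nonzero scalars, and ultrametric. -/
structure Weight (V : Type*) [AddCommGroup V] [Module ℝ V] where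
  toFun : V → WithBot ℝ
  eq_bot_iff : ∀ v, toFun v = ⊥ ↔ v = 0
  smul_eq : ∀ (c : ℝ) (v : V), c ≠ 0 → toFun (c • v) = toFun v
  add_le : ∀ v w, toFun (v + w) ≤ max (toFun v) (toFun w)

namespace Weight

section Basic

variable {V : Type*} [AddCommGroup V] [Module ℝ V]

/-- The real number `ϖ(v)` for `v ≠ 0`; the value at `v = 0` is irrelevant. -/
def val (w : Weight V) (v : V) : ℝ := (w.toFun v).unbotD 0

/-- `ϖ(v)` as an extended real number, with `ϖ(0) = -∞`. -/
def eval (w : Weight V) (v : V) : EReal := WithBot.recBotCoe ⊥ (fun a : ℝ => (a : EReal)) (w.toFun v)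

/-- The finite values taken by the weight. -/
def values (w : Weight V) : Set ℝ := {a | ∃ v, w.toFun v = (a : WithBot ℝ)}

theorem toFun_zero (w : Weight V) : w.toFun 0 = ⊥ := (w.eq_bot_iff 0).2 rfl

theorem smul_le (w : Weight V) (c : ℝ) (v : V) : w.toFun (c • v) ≤ w.toFun v := by
  by_cases hc : c = 0
  · simp [hc, w.toFun_zero]
  · exact (w.smul_eq c v hc).le

/-- The subspace `V_{≤ a}`. -/
def le (w : Weight V) (a : ℝ) : Submodule ℝ V where
  carrier := {v | w.toFun v ≤ (a : WithBot ℝ)}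
  zero_mem' := by simp [w.toFun_zero]
  add_mem' := fun {x y} hx hy => (w.add_le x y).trans (max_le hx hy)
  smul_mem' := fun c x hx => (w.smul_le c x).trans hx

/-- The subspace `V_{< a}`. -/
def lt (w : Weight V) (a : ℝ) : Submodule ℝ V where
  carrier := {v | w.toFun v < (a : WithBot ℝ)}
  zero_mem' := by simp [w.toFun_zero]
  add_mem' := fun {x y} hx hy => (w.add_le x y).trans_lt (max_lt hx hy)
  smul_mem' := fun c x hx => (w.smul_le c x).trans_lt hx

/-- The multiplicity `dim (V_{≤ a} / V_{< a})` of the weight `a`. -/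
def mult (w : Weight V) (a : ℝ) : ℕ :=
  Module.finrank ℝ (w.le a ⧸ (w.lt a).submoduleOf (w.le a))

end Basic

/-- Two weights are compatible if they take the same values with the same multiplicities. -/
def Compatible {V W : Type*} [AddCommGroup V] [Module ℝ V] [AddCommGroup W] [Module ℝ W]
    (wV : Weight V) (wW : Weight W) : Prop :=
  wV.values = wW.values ∧ ∀ a, wV.mult a = wW.mult a

end Weight

/-! ### Polynomial maps -/

section Poly

variable {V : Type*} [NormedAddCommGroup V] [NormedSpace ℝ V]
variable {W : Type*} [NormedAddCommGroup W] [NormedSpace ℝ W]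

/-- `f` is a polynomial map: a finite sum of homogeneous polynomial maps. -/
def IsPolynomialMap (f : V → W) : Prop :=
  ∃ (d : ℕ) (p : ∀ k : ℕ, ContinuousMultilinearMap ℝ (fun _ : Fin k => V) W),
    ∀ x, f x = ∑ k ∈ Finset.range (d + 1), p k (fun _ => x)

/-- The `k`-th normalized derivative tensor `(1/k!) D^k_0 f`. For a polynomial map this is the
polarization of its homogeneous component of degree `k`; for `k = 0` it is `f 0`. -/
def polarization (f : V → W) (k : ℕ) : ContinuousMultilinearMap ℝ (fun _ : Fin k => V) W :=
  ((k.factorial : ℝ)⁻¹) • iteratedFDeriv ℝ k f 0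

/-- The weight of a multilinear map `T`: the largest value of `ϖ(T(v₁,…,v_k)) - ∑ ϖ(v_i)` over
nonzero `v_i`; it is `-∞` for `T = 0`. -/
def multilinearWeight (wV : Weight V) (wW : Weight W) {k : ℕ}
    (T : ContinuousMultilinearMap ℝ (fun _ : Fin k => V) W) : EReal :=
  ⨆ (v : Fin k → V) (_ : ∀ i, v i ≠ 0), wW.eval (T v) - ((∑ i, wV.val (v i) : ℝ) : EReal)

/-- The weight of a polynomial map: the largest weight of its homogeneous components. -/
def polyWeight (wV : Weight V) (wW : Weight W) (f : V → W) : EReal :=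
  ⨆ k : ℕ, multilinearWeight wV wW (polarization f k)

/-- Subresonant polynomial maps. -/
def IsSubresonant (wV : Weight V) (wW : Weight W) (f : V → W) : Prop :=
  IsPolynomialMap f ∧ polyWeight wV wW f ≤ 0

/-- Invertible subresonant polynomial maps: the derivative at `0` is invertible. -/
def IsInvertibleSubresonant (wV : Weight V) (wW : Weight W) (f : V → W) : Prop :=
  IsSubresonant wV wW f ∧ Function.Bijective (fderiv ℝ f 0)

/-- The norm of a polynomial map: the sum of the operator norms of its polarizations. The sum has
finite support for every polynomial map. -/
def polyNorm (f : V → W) : ℝ := ∑ᶠ k : ℕ, ‖polarization f k‖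

end Poly

/-- The composition `f_{n-1} ∘ ⋯ ∘ f_0`. -/
def iterComp {V : ℕ → Type*} (f : ∀ j, V j → V (j + 1)) : ∀ n, V 0 → V n
  | 0 => id
  | n + 1 => f n ∘ iterComp f n

/-! ### Functions of class `C^r`, for real `r` -/

section Cr

variable {V : Type*} [NormedAddCommGroup V] [NormedSpace ℝ V]
variable {W : Type*} [NormedAddCommGroup W] [NormedSpace ℝ W]

/-- `φ` is of class `C^r` on the open set `U`: it is `⌊r⌋` times continuously differentiable and,
if `r` is not an integer, the derivative of order `⌊r⌋` is locally Hölder of exponent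
`r - ⌊r⌋`. -/
def IsCr (r : ℝ) (U : Set V) (φ : V → W) : Prop :=
  ContDiffOn ℝ (⌊r⌋₊ : ℕ) φ U ∧
    (Int.fract r ≠ 0 → ∀ x ∈ U, ∃ t ∈ 𝓝[U] x, ∃ C : ℝ≥0,
      HolderOnWith C (Int.fract r).toNNReal (iteratedFDeriv ℝ ⌊r⌋₊ φ) t)

open Classical in
/-- The `C^r` norm on the open set `U`: the supremum over `U` of all derivatives of order at most
`⌊r⌋`, plus, if `r` is not an integer, the Hölder seminorm of exponent `r - ⌊r⌋` of the derivative
of order `⌊r⌋`. -/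
def crNorm (r : ℝ) (U : Set V) (φ : V → W) : ℝ≥0∞ :=
  (⨆ k ∈ Finset.range (⌊r⌋₊ + 1), ⨆ x ∈ U, ‖iteratedFDeriv ℝ k φ x‖ₑ) +
    if Int.fract r = 0 then 0 else
      ⨆ x ∈ U, ⨆ y ∈ U, ⨆ _ : x ≠ y,
        edist (iteratedFDeriv ℝ ⌊r⌋₊ φ x) (iteratedFDeriv ℝ ⌊r⌋₊ φ y) / edist x y ^ Int.fract r

end Cr

/-! ### Admissible errors

The weights `λ₁ < ⋯ < λ_ℓ` are written `lam : Fin (l + 1) → ℝ` and the weights `η₁ < ⋯ < η_p` are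
written `eta : Fin (p + 1) → ℝ`. -/

section Eps

variable {l p : ℕ} (lam : Fin (l + 1) → ℝ) (eta : Fin (p + 1) → ℝ)

/-- `d₁ = ⌊λ₁/λ_ℓ⌋`. -/
def d1 : ℕ := ⌊lam 0 / lam (Fin.last l)⌋₊

/-- `d₂ = ⌊λ₁/η_p⌋`. -/
def d2 : ℕ := ⌊lam 0 / eta (Fin.last p)⌋₊

/-- `d₃ = ⌊η₁/η_p⌋`. -/
def d3 : ℕ := ⌊eta 0 / eta (Fin.last p)⌋₊

/-- `d = max {d₁, d₂, d₃}`. -/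
def dmax : ℕ := max (d1 lam) (max (d2 lam eta) (d3 eta))

/-- `s = min {r, d₂ + 1}`. -/
def sExp (r : ℝ) : ℝ := min r (d2 lam eta + 1)

/-- The smallness condition on `ε`: it is positive; `10 d ε` is smaller than `1`, `-λ_ℓ`, `-η_p`
and all positive gaps `λ_i - (η_{j₁} + ⋯ + η_{j_k})` with `1 ≤ k ≤ d₂`; and
`ε < (λ₁ - s η_p) / (3 s + 2)`. -/
structure AdmissibleEps (r ε : ℝ) : Prop where
  pos : 0 < ε
  lt_one : 10 * dmax lam eta * ε < 1
  lt_lam : 10 * dmax lam eta * ε < -lam (Fin.last l)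
  lt_eta : 10 * dmax lam eta * ε < -eta (Fin.last p)
  lt_gap : ∀ (i : Fin (l + 1)) (k : ℕ) (J : Fin k → Fin (p + 1)), 1 ≤ k → k ≤ d2 lam eta →
    0 < lam i - ∑ m, eta (J m) → 10 * dmax lam eta * ε < lam i - ∑ m, eta (J m)
  lt_reg : ε < (lam 0 - sExp lam eta r * eta (Fin.last p)) / (3 * sExp lam eta r + 2)

end Eps

end Subres

end

/-!
The function `φ 0` agrees with its Taylor polynomial `h` of degree `N = ⌊λ₁ / η_p⌋` at `0`. The
iterates `F n` of the `f j` and `G n` of the `g j` are polynomials with fixed point `0`, and the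
proof compares their rates of contraction.

* The coefficient of degree `k` of `F n`, applied to vectors `v₁, …, v_k`, is
  `O(exp (n (∑ ϖ(v_i) + (2 k - 1) ε)))`: see `SubresonantCocycle.exists_norm_iterSeries_le`. As all
  weights are negative, the nonlinear part of `F n` is therefore negligible compared to its linear
  part. In particular `F n a - F n b` is asymptotic to the linear part of `F n` applied to `a - b`,
  and the lower bound on the latter shows that the iterates of distinct points cannot approach each
  other faster than `exp (n (λ₁ - ε))`: see `SubresonantCocycle.eq_of_expSmall_iterComp_sub`.
  Here the lower bound is only used at one vector at a time, so that it does not matter that it is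
  not uniform, and the inverses of the `f j` and `g j` do not appear.

* Let `h n` be the Taylor polynomial of degree `N` of `φ n`, so that `h = h 0`. The relation
  `F n ∘ φ 0 = φ n ∘ G n` gives `F n ∘ h = h n ∘ G n` up to terms of order higher than `N`. Let
  `c t^β` be a term of `h`, in coordinates `t` along vectors with given weights. In the left-hand
  side, the coefficient of `t^β` is dominated by the linear part of `F n` applied to `c`, hence it
  is at least of size `exp (n (ϖ(c) - ε))`, if `ϖ(c)` exceeds the weight of `β` and the terms of
  lower degree are subresonant. In the right-hand side it is at most of size
  `exp (n (ϖ(β) + (2 |β| - 1) ε))` for the `n` with `h n` bounded. As `ε` is small compared to the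
  gap between `ϖ(c)` and the weight `ϖ(β)` of `β`, it follows by induction on the degree that `h` is
  subresonant: see `JetConjugacy.jetCoeff_mem_le`.

* Consequently `F n ∘ h` has no terms of degree higher than `N`, while those of `h n ∘ G n` are
  `o(exp (n (λ₁ - ε)))`; and so is the remainder `(φ n - h n)(G n x) = O(‖G n x‖ ^ s)`. Hence
  `F n (φ 0 x) - F n (h x)` is `o(exp (n (λ₁ - ε)))`, and `φ 0 x = h x` by the first point.
-/

noncomputable section

namespace Subres

/-! ### Weights and filtrations -/

namespace Weight

section Basic

variable {V : Type*} [AddCommGroup V] [Module ℝ V] (w : Weight V)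

theorem toFun_eq_val {v : V} (hv : v ≠ 0) : w.toFun v = (w.val v : WithBot ℝ) := by
  have h : w.toFun v ≠ ⊥ := fun h => hv ((w.eq_bot_iff v).1 h)
  obtain ⟨a, ha⟩ := WithBot.ne_bot_iff_exists.1 h
  simp [val, ← ha]

theorem mem_le {v : V} {a : ℝ} : v ∈ w.le a ↔ w.toFun v ≤ (a : WithBot ℝ) := Iff.rfl

theorem mem_le_iff {v : V} (hv : v ≠ 0) {a : ℝ} : v ∈ w.le a ↔ w.val v ≤ a := by
  rw [mem_le, toFun_eq_val w hv, WithBot.coe_le_coe]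

theorem mem_le_val (v : V) : v ∈ w.le (w.val v) := by
  by_cases hv : v = 0
  · rw [hv]; exact Submodule.zero_mem _
  · exact (w.mem_le_iff hv).2 le_rfl

theorem le_mono {a b : ℝ} (hab : a ≤ b) : w.le a ≤ w.le b := fun _ hv =>
  le_trans (w.mem_le.1 hv) (WithBot.coe_le_coe.2 hab)

theorem val_mem_values {v : V} (hv : v ≠ 0) : w.val v ∈ w.values := ⟨v, w.toFun_eq_val hv⟩

theorem eq_zero_of_mem_le {v : V} {a b : ℝ} (hb : ∀ c ∈ w.values, b ≤ c) (hab : a < b)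
    (hv : v ∈ w.le a) : v = 0 := by
  by_contra h
  have := (w.mem_le_iff h).1 hv
  linarith [hb _ (w.val_mem_values h)]

theorem mem_le_of_values_le (v : V) {b : ℝ} (hb : ∀ c ∈ w.values, c ≤ b) : v ∈ w.le b := by
  by_cases hv : v = 0
  · rw [hv]; exact Submodule.zero_mem _
  · exact (w.mem_le_iff hv).2 (hb _ (w.val_mem_values hv))

theorem eval_sub_nonpos_iff (v : V) (a : ℝ) : w.eval v - (a : EReal) ≤ 0 ↔ v ∈ w.le a := by
  by_cases hv : v = 0
  · subst hv
    simp [eval, w.toFun_zero, WithBot.recBotCoe]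
  · rw [w.mem_le_iff hv, eval, w.toFun_eq_val hv]
    change ((w.val v : ℝ) : EReal) - (a : EReal) ≤ 0 ↔ _
    rw [← EReal.coe_sub, ← EReal.coe_zero, EReal.coe_le_coe_iff, sub_nonpos]

end Basic

end Weight

section Poly

variable {V : Type*} [NormedAddCommGroup V] [NormedSpace ℝ V]
variable {W : Type*} [NormedAddCommGroup W] [NormedSpace ℝ W]

theorem polyWeight_nonpos_iff (wV : Weight V) (wW : Weight W) (f : V → W) :
    polyWeight wV wW f ≤ 0 ↔ ∀ (k : ℕ) (v : Fin k → V), (∀ i, v i ≠ 0) →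
      polarization f k v ∈ wW.le (∑ i, wV.val (v i)) := by
  simp only [polyWeight, multilinearWeight, iSup_le_iff, Weight.eval_sub_nonpos_iff]

/-- In contrast to the definition of subresonance, zero arguments are allowed here. -/
theorem IsSubresonant.polarization_mem_le {wV : Weight V} {wW : Weight W} {f : V → W}
    (hf : IsSubresonant wV wW f) (k : ℕ) (v : Fin k → V) (b : Fin k → ℝ)
    (hb : ∀ i, v i ∈ wV.le (b i)) : polarization f k v ∈ wW.le (∑ i, b i) := by
  by_cases h : ∀ i, v i ≠ 0
  · exact wW.le_mono (Finset.sum_le_sum fun i _ => (wV.mem_le_iff (h i)).1 (hb i))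
      ((polyWeight_nonpos_iff wV wW f).1 hf.2 k v h)
  · push Not at h
    obtain ⟨i, hi⟩ := h
    rw [(polarization f k).map_coord_zero i hi]
    exact Submodule.zero_mem _

/-- The Taylor series of `f` at `0`, as a formal multilinear series. -/
def taylorSeries (f : V → W) : FormalMultilinearSeries ℝ V W := fun k => polarization f k

/-- The coefficients of a finite sum of homogeneous polynomials, padded by zeros. -/
def truncSeries (d : ℕ) (p : ∀ k : ℕ, ContinuousMultilinearMap ℝ (fun _ : Fin k => V) W) :
    FormalMultilinearSeries ℝ V W := fun k => if k < d then p k else 0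

theorem hasFiniteFPowerSeriesOnBall_truncSeries (d : ℕ)
    (p : ∀ k : ℕ, ContinuousMultilinearMap ℝ (fun _ : Fin k => V) W) :
    HasFiniteFPowerSeriesOnBall (fun x => ∑ k ∈ Finset.range d, p k (fun _ => x))
      (truncSeries d p) 0 d ⊤ := by
  refine HasFiniteFPowerSeriesOnBall.mk' (fun m hm => ?_) ENNReal.zero_lt_top fun y _ => ?_
  · simp [truncSeries, not_lt.2 hm]
  · simp only [zero_add]
    refine Finset.sum_congr rfl fun k hk => ?_
    simp [truncSeries, Finset.mem_range.1 hk]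

theorem polarization_sum_apply [CompleteSpace W] (d : ℕ)
    (p : ∀ k : ℕ, ContinuousMultilinearMap ℝ (fun _ : Fin k => V) W) (k : ℕ) (v : Fin k → V) :
    polarization (fun x => ∑ j ∈ Finset.range d, p j (fun _ => x)) k v =
      (k.factorial : ℝ)⁻¹ • if k < d then ∑ σ : Equiv.Perm (Fin k), p k (fun i => v (σ i))
        else 0 := by
  have h := (hasFiniteFPowerSeriesOnBall_truncSeries d p).toHasFPowerSeriesOnBall
  rw [polarization, smul_apply,
    h.iteratedFDeriv_eq_sum_of_completeSpace]
  congr 1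
  split_ifs with hk <;> simp [truncSeries, hk]

theorem IsPolynomialMap.exists_hasFiniteFPowerSeriesOnBall [CompleteSpace W] {f : V → W}
    (hf : IsPolynomialMap f) :
    ∃ d, HasFiniteFPowerSeriesOnBall f (taylorSeries f) 0 d ⊤ := by
  obtain ⟨d, p, hp⟩ := hf
  obtain rfl : f = fun x => ∑ k ∈ Finset.range (d + 1), p k (fun _ => x) := funext hp
  have h := (hasFiniteFPowerSeriesOnBall_truncSeries (d + 1) p).toHasFPowerSeriesOnBall
  refine ⟨d + 1, HasFiniteFPowerSeriesOnBall.mk' (fun m hm => ?_) ENNReal.zero_lt_top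
    fun y _ => ?_⟩
  · ext v
    rw [taylorSeries, polarization_sum_apply]
    simp [not_lt.2 hm]
  · simp only [zero_add]
    refine Finset.sum_congr rfl fun k hk => ?_
    rw [taylorSeries, polarization_sum_apply, if_pos (Finset.mem_range.1 hk)]
    simp only [Finset.sum_const, Finset.card_univ, Fintype.card_perm, Fintype.card_fin]
    rw [← Nat.cast_smul_eq_nsmul ℝ, smul_smul, inv_mul_cancel₀ (by positivity), one_smul]

theorem IsPolynomialMap.norm_polarization_le [CompleteSpace W] {f : V → W}
    (hf : IsPolynomialMap f) (k : ℕ) : ‖polarization f k‖ ≤ polyNorm f := by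
  obtain ⟨d, hd⟩ := hf.exists_hasFiniteFPowerSeriesOnBall
  have hfin : (Function.support fun k => ‖polarization f k‖).Finite := by
    refine (Set.finite_lt_nat d).subset fun m hm => ?_
    by_contra h
    exact hm (by simpa [taylorSeries] using hd.finite m (not_lt.1 h))
  exact single_le_finsum k hfin fun _ => norm_nonneg _

theorem polarization_one_apply (f : V → W) (v : Fin 1 → V) :
    polarization f 1 v = fderiv ℝ f 0 (v 0) := by
  simp [polarization]

theorem polarization_zero_apply (f : V → W) (v : Fin 0 → V) : polarization f 0 v = f 0 := by
  simp [polarization]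

end Poly

/-! ### Growth of the Taylor coefficients of the iterates -/

theorem exists_le_mul_pow_of_le_mul_add {a : ℕ → ℝ} {x y K : ℝ} (hx : 0 ≤ x) (hxy : x < y)
    (hK : 0 ≤ K) (h : ∀ n, a (n + 1) ≤ x * a n + K * y ^ n) :
    ∃ A, 0 ≤ A ∧ ∀ n, a n ≤ A * y ^ n := by
  set A := max (a 0) (K / (y - x)) with hA
  have h1 : K ≤ A * (y - x) := (div_le_iff₀ (by linarith)).1 (le_max_right _ _)
  refine ⟨A, le_max_of_le_right (div_nonneg hK (by linarith)), fun n => ?_⟩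
  induction n with
  | zero => simp [hA]
  | succ n ih =>
    have hy : 0 ≤ y ^ n := pow_nonneg (hx.trans hxy.le) n
    calc a (n + 1) ≤ x * (A * y ^ n) + K * y ^ n := by
          linarith [h n, mul_le_mul_of_nonneg_left ih hx]
      _ ≤ x * (A * y ^ n) + A * (y - x) * y ^ n := by gcongr
      _ = A * y ^ (n + 1) := by ring

section Cocycle

variable {E : ℕ → Type*} [∀ j, NormedAddCommGroup (E j)] [∀ j, NormedSpace ℝ (E j)]

/-- The Taylor series at `0` of the iterate `iterComp f n`, provided all `f j` fix `0`. -/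
def iterSeries (f : ∀ j, E j → E (j + 1)) : ∀ n, FormalMultilinearSeries ℝ (E 0) (E n)
  | 0 => FormalMultilinearSeries.id ℝ (E 0) 0
  | n + 1 => (taylorSeries (f n)).comp (iterSeries f n)

/-- The common hypotheses on the two sequences of maps: subresonant maps fixing `0`, whose linear
parts contract each weight space at its own rate up to `ε` and whose norms grow at most like
`exp (ε j)`. -/
structure SubresonantCocycle (w : ∀ j, Weight (E j)) (f : ∀ j, E j → E (j + 1)) (ε C : ℝ) :
    Prop where
  subres : ∀ j, IsSubresonant (w j) (w (j + 1)) (f j)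
  map_zero : ∀ j, f j 0 = 0
  norm_fderiv_le : ∀ j v, ‖fderiv ℝ (f j) 0 v‖ ≤ Real.exp ((w j).val v + ε) * ‖v‖
  polyNorm_le : ∀ j : ℕ, polyNorm (f j) ≤ C * Real.exp (ε * j)

/-- All weights lie in the interval from `a` to `L`, and `k` copies of `L` add up to less than `a` as
soon as `k ≥ D`. For negative `L` this makes subresonant maps have degree less than `D`. -/
structure WeightBounds (w : ∀ j, Weight (E j)) (a L : ℝ) (D : ℕ) : Prop where
  le : ∀ j, ∀ c ∈ (w j).values, c ≤ L
  ge : ∀ j, ∀ c ∈ (w j).values, a ≤ c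
  mul_lt : ∀ k : ℕ, D ≤ k → k * L < a

variable {w : ∀ j, Weight (E j)} {f : ∀ j, E j → E (j + 1)} {ε C : ℝ}

namespace SubresonantCocycle

theorem iterSeries_zero_coeff (h : SubresonantCocycle w f ε C) (n : ℕ) (v : Fin 0 → E 0) :
    iterSeries f n 0 v = 0 := by
  cases n with
  | zero => simp [iterSeries]
  | succ n =>
    rw [iterSeries, FormalMultilinearSeries.comp_coeff_zero _ _ _ (fun i => i.elim0), taylorSeries,
      polarization_zero_apply, h.map_zero]

theorem iterComp_zero (h : SubresonantCocycle w f ε C) (n : ℕ) : iterComp f n 0 = 0 := by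
  induction n with
  | zero => rfl
  | succ n ih => simp [iterComp, ih, h.map_zero]

theorem iterSeries_mem_le (h : SubresonantCocycle w f ε C) (n k : ℕ) (v : Fin k → E 0)
    (b : Fin k → ℝ) (hb : ∀ i, v i ∈ (w 0).le (b i)) :
    iterSeries f n k v ∈ (w n).le (∑ i, b i) := by
  induction n generalizing k with
  | zero =>
    match k with
    | 0 => simp [iterSeries]
    | 1 => simpa [iterSeries] using hb 0
    | k + 2 => simp [iterSeries]
  | succ n ih =>
    rw [iterSeries, FormalMultilinearSeries.comp, sum_apply]
    refine Submodule.sum_mem _ fun c _ => ?_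
    rw [FormalMultilinearSeries.compAlongComposition_apply, ← c.sum_sum_apply_embedding]
    exact (h.subres n).polarization_mem_le _ _ _ fun i => ih _ _ _ fun j => hb _

theorem norm_taylorSeries_one_le (h : SubresonantCocycle w f ε C) (j : ℕ) (v : Fin 1 → E j)
    {b : ℝ} (hb : v 0 ∈ (w j).le b) :
    ‖taylorSeries (f j) 1 v‖ ≤ Real.exp (b + ε) * ‖v 0‖ := by
  rw [taylorSeries, polarization_one_apply]
  by_cases hv : v 0 = 0
  · simp [hv]
  · refine (h.norm_fderiv_le j (v 0)).trans ?_
    gcongr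
    exact ((w j).mem_le_iff hv).1 hb

theorem norm_comp_single_le (h : SubresonantCocycle w f ε C) (n k : ℕ) (hk : 0 < k)
    (v : Fin k → E 0) (b : Fin k → ℝ) (hb : ∀ i, v i ∈ (w 0).le (b i)) :
    ‖(taylorSeries (f n)).compAlongComposition (iterSeries f n) (Composition.single k hk) v‖ ≤
      Real.exp (∑ i, b i + ε) * ‖iterSeries f n k v‖ := by
  rw [FormalMultilinearSeries.compAlongComposition_apply,
    FormalMultilinearSeries.applyComposition_single]
  exact h.norm_taylorSeries_one_le n _ (h.iterSeries_mem_le n k v b hb)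

theorem iterSeries_one_apply (n : ℕ) (v : Fin 1 → E 0) :
    iterSeries f (n + 1) 1 v = taylorSeries (f n) 1 fun _ => iterSeries f n 1 v := by
  rw [iterSeries, FormalMultilinearSeries.comp_coeff_one]

/-- The growth of the Taylor coefficients of the iterates. Along the linear part of `f n` the bound
`exp (n (∑ b + (2 k - 1) ε))` is propagated with an additional factor `exp ε`, which is harmless if
`k ≥ 2`. The terms coming from the part of degree `m ≥ 2` of `f n` are products of `m` coefficients
of degrees `k₁ + ⋯ + k_m = k`, so that their exponent is `∑ (2 k_i - 1) + 1 = 2 k - m + 1` at most,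
where the last `1` accounts for the growth of the norm of `f n`. -/
theorem exists_norm_iterSeries_le (h : SubresonantCocycle w f ε C)
    [∀ j, FiniteDimensional ℝ (E j)] (hε : 0 < ε) (k : ℕ)
    (v : Fin k → E 0) (b : Fin k → ℝ) (hb : ∀ i, v i ∈ (w 0).le (b i)) :
    ∃ A, 0 ≤ A ∧ ∀ n, ‖iterSeries f n k v‖ ≤ A * Real.exp (∑ i, b i + (2 * k - 1) * ε) ^ n := by
  have hcomplete : ∀ j, CompleteSpace (E j) := fun j => FiniteDimensional.complete ℝ (E j)
  induction k using Nat.strong_induction_on with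
  | _ k ih =>
    match k with
    | 0 => exact ⟨0, le_rfl, fun n => by simp [h.iterSeries_zero_coeff]⟩
    | 1 =>
      refine ⟨‖iterSeries f 0 1 v‖, norm_nonneg _, fun n => ?_⟩
      induction n with
      | zero => simp
      | succ n ihn =>
        rw [iterSeries_one_apply]
        refine (h.norm_taylorSeries_one_le n _ (h.iterSeries_mem_le n 1 v b hb)).trans ?_
        refine (mul_le_mul_of_nonneg_left ihn (Real.exp_pos _).le).trans (le_of_eq ?_)
        norm_num
        ring
    | k + 2 =>
      have hk : 0 < k + 2 := by omega
      have hC : 0 ≤ C := by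
        have := (norm_nonneg _).trans
          (((h.subres 0).1.norm_polarization_le 0).trans (h.polyNorm_le 0))
        simpa using this
      set s := ∑ i, b i with hs
      set y := Real.exp (s + (2 * (k + 2 : ℕ) - 1) * ε) with hy
      have hcomp : ∀ c : Composition (k + 2), c ≠ Composition.single (k + 2) hk → ∃ K, 0 ≤ K ∧
          ∀ n, ‖(taylorSeries (f n)).compAlongComposition (iterSeries f n) c v‖ ≤ K * y ^ n := by
        intro c hc
        have hlt := (Composition.ne_single_iff hk).1 hc
        have hlen : 2 ≤ c.length := by
          have h1 := (Composition.eq_single_iff_length hk).not.1 hc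
          have h2 := c.length_pos_iff.2 hk
          omega
        choose A hA0 hA using fun i : Fin c.length =>
          ih (c.blocksFun i) (hlt i) (v ∘ c.embedding i) (b ∘ c.embedding i) fun j => hb _
        refine ⟨C * ∏ i, A i, mul_nonneg hC (Finset.prod_nonneg fun i _ => hA0 i), fun n => ?_⟩
        have hexp : Real.exp (ε * n) * ∏ i : Fin c.length,
            Real.exp (∑ j, (b ∘ c.embedding i) j + (2 * (c.blocksFun i : ℝ) - 1) * ε) ^ n ≤
              y ^ n := by
          rw [Finset.prod_pow, ← Real.exp_sum, hy, mul_comm ε, Real.exp_nat_mul, ← mul_pow,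
            ← Real.exp_add]
          refine pow_le_pow_left₀ (Real.exp_pos _).le (Real.exp_le_exp.2 ?_) n
          rw [Finset.sum_add_distrib]
          have e1 : ∑ i, ∑ j, (b ∘ c.embedding i) j = s := c.sum_sum_apply_embedding b
          have e2 : ∑ i : Fin c.length, (2 * (c.blocksFun i : ℝ) - 1) * ε =
              (2 * (k + 2 : ℕ) - c.length) * ε := by
            rw [← Finset.sum_mul, Finset.sum_sub_distrib, ← Finset.mul_sum, ← Nat.cast_sum,
              c.sum_blocksFun]
            simp
          rw [e1, e2]
          have e3 : (2 : ℝ) ≤ c.length := by exact_mod_cast hlen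
          nlinarith
        rw [FormalMultilinearSeries.compAlongComposition_apply]
        calc ‖taylorSeries (f n) c.length ((iterSeries f n).applyComposition c v)‖
            ≤ ‖taylorSeries (f n) c.length‖ *
                ∏ i, ‖(iterSeries f n).applyComposition c v i‖ :=
              ContinuousMultilinearMap.le_opNorm _ _
          _ ≤ (C * Real.exp (ε * n)) * ∏ i, (A i *
                Real.exp (∑ j, (b ∘ c.embedding i) j + (2 * (c.blocksFun i : ℝ) - 1) * ε) ^ n) := by
              gcongr with i
              · exact ((h.subres n).1.norm_polarization_le _).trans (h.polyNorm_le n)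
              · exact hA i n
          _ = (C * ∏ i, A i) * (Real.exp (ε * n) * ∏ i : Fin c.length,
                Real.exp (∑ j, (b ∘ c.embedding i) j + (2 * (c.blocksFun i : ℝ) - 1) * ε) ^ n) := by
              rw [Finset.prod_mul_distrib]; ring
          _ ≤ (C * ∏ i, A i) * y ^ n := by
              gcongr
              exact mul_nonneg hC (Finset.prod_nonneg fun i _ => hA0 i)
      choose! K hK0 hK using hcomp
      have hKsum : 0 ≤ ∑ c ∈ Finset.univ.erase (Composition.single (k + 2) hk), K c :=
        Finset.sum_nonneg fun c hc => hK0 c (Finset.ne_of_mem_erase hc)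
      refine exists_le_mul_pow_of_le_mul_add (x := Real.exp (s + ε)) (Real.exp_pos _).le ?_ hKsum
        fun n => ?_
      · rw [hy, Real.exp_lt_exp]
        push_cast
        nlinarith [(Nat.cast_nonneg k : (0 : ℝ) ≤ k)]
      · rw [iterSeries, FormalMultilinearSeries.comp, sum_apply,
          ← Finset.add_sum_erase _ _ (Finset.mem_univ (Composition.single (k + 2) hk))]
        refine (norm_add_le _ _).trans (add_le_add (h.norm_comp_single_le n _ hk v b hb) ?_)
        rw [Finset.sum_mul]
        exact (norm_sum_le _ _).trans
          (Finset.sum_le_sum fun c hc => hK c (Finset.ne_of_mem_erase hc) n)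

theorem hasFPowerSeriesAt_iterComp (h : SubresonantCocycle w f ε C)
    [∀ j, FiniteDimensional ℝ (E j)] (n : ℕ) :
    HasFPowerSeriesAt (iterComp f n) (iterSeries f n) 0 := by
  have hcomplete : ∀ j, CompleteSpace (E j) := fun j => FiniteDimensional.complete ℝ (E j)
  induction n with
  | zero =>
    refine (HasFiniteFPowerSeriesOnBall.mk' (n := 2) (r := ⊤) (fun m hm => ?_)
      ENNReal.zero_lt_top fun y _ => ?_).toHasFPowerSeriesOnBall.hasFPowerSeriesAt
    · exact FormalMultilinearSeries.id_apply_of_one_lt ℝ (E 0) 0 hm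
    · simp [iterComp, iterSeries, Finset.sum_range_succ]
  | succ n ih =>
    refine HasFPowerSeriesAt.comp ?_ ih
    rw [h.iterComp_zero]
    obtain ⟨d, hd⟩ := (h.subres n).1.exists_hasFiniteFPowerSeriesOnBall
    exact hd.toHasFPowerSeriesOnBall.hasFPowerSeriesAt

theorem analyticAt_iterComp (h : SubresonantCocycle w f ε C)
    [∀ j, FiniteDimensional ℝ (E j)] (n : ℕ) (x : E 0) : AnalyticAt ℝ (iterComp f n) x := by
  have hcomplete : ∀ j, CompleteSpace (E j) := fun j => FiniteDimensional.complete ℝ (E j)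
  induction n with
  | zero => exact analyticAt_id
  | succ n ih =>
    obtain ⟨d, hd⟩ := (h.subres n).1.exists_hasFiniteFPowerSeriesOnBall
    exact AnalyticAt.comp (hd.toHasFPowerSeriesOnBall.analyticOnNhd _ (by simp)) ih

theorem iterSeries_eq_zero (h : SubresonantCocycle w f ε C) {a L : ℝ} {D : ℕ}
    (hB : WeightBounds w a L D) (n k : ℕ) (hk : D ≤ k) : iterSeries f n k = 0 := by
  ext v
  refine (w n).eq_zero_of_mem_le (hB.ge n) (hB.mul_lt k hk) ?_
  have := h.iterSeries_mem_le n k v (fun _ => L) fun i => (w 0).mem_le_of_values_le _ (hB.le 0)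
  simpa using this

/-- Since coefficients of high degree vanish for reasons of weight, the iterates are
polynomials whose degree is bounded independently of `n`. -/
theorem iterComp_eq_sum (h : SubresonantCocycle w f ε C)
    [∀ j, FiniteDimensional ℝ (E j)] {a L : ℝ} {D : ℕ}
    (hB : WeightBounds w a L D) (n : ℕ) (x : E 0) :
    iterComp f n x = ∑ k : Fin D, iterSeries f n k (fun _ => x) := by
  have hcomplete : ∀ j, CompleteSpace (E j) := fun j => FiniteDimensional.complete ℝ (E j)
  have hz := h.iterSeries_eq_zero hB n
  have hfin := (iterSeries f n).hasFiniteFPowerSeriesOnBall_of_finite hz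
  have h1 : iterComp f n = (iterSeries f n).sum := by
    refine AnalyticOnNhd.eq_of_eventuallyEq (𝕜 := ℝ) (z₀ := 0)
      (fun x _ => h.analyticAt_iterComp n x)
      (fun x _ => hfin.toHasFPowerSeriesOnBall.analyticOnNhd x (by simp)) ?_
    have h2 := (h.hasFPowerSeriesAt_iterComp n).eventually_hasSum
    filter_upwards [h2] with y hy
    rw [zero_add] at hy
    exact hy.tsum_eq.symm
  rw [h1, (iterSeries f n).sum_of_finite hz, FormalMultilinearSeries.partialSum,
    Finset.sum_range]

theorem iterSeries_one_eq_fderiv (h : SubresonantCocycle w f ε C)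
    [∀ j, FiniteDimensional ℝ (E j)] (n : ℕ) (v : Fin 1 → E 0) :
    iterSeries f n 1 v = fderiv ℝ (iterComp f n) 0 (v 0) := by
  rw [(h.hasFPowerSeriesAt_iterComp n).fderiv_eq, continuousMultilinearCurryFin1_apply]
  congr 1
  ext i
  simp [Subsingleton.elim i 0, Fin.snoc]

end SubresonantCocycle

end Cocycle

/-! ### Comparison of the iterates with their linear parts -/

section Cocycle

open Asymptotics

theorem isLittleO_exp_pow_exp_pow {a b : ℝ} (h : a < b) :
    (fun n : ℕ => Real.exp a ^ n) =o[atTop] fun n => Real.exp b ^ n :=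
  isLittleO_pow_pow_of_lt_left (Real.exp_pos _).le (Real.exp_lt_exp.2 h)

theorem isBigO_exp_pow_exp_pow {a b : ℝ} (h : a ≤ b) :
    (fun n : ℕ => Real.exp a ^ n) =O[atTop] fun n => Real.exp b ^ n :=
  isBigO_of_le _ fun n => by
    rw [Real.norm_of_nonneg (by positivity), Real.norm_of_nonneg (by positivity)]
    gcongr

theorem sum_le_add_mul_of_le {m : ℕ} {c : Fin m → ℝ} {L x : ℝ} (i₀ : Fin m)
    (hx : c i₀ ≤ x) (hL : ∀ i, c i ≤ L) : ∑ i, c i ≤ x + (m - 1) * L := by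
  rw [← Finset.add_sum_erase _ _ (Finset.mem_univ i₀)]
  refine add_le_add hx ((Finset.sum_le_card_nsmul _ _ L fun i _ => hL i).trans (le_of_eq ?_))
  have : 1 ≤ m := by have := i₀.2; omega
  rw [Finset.card_erase_of_mem (Finset.mem_univ _), Finset.card_univ, Fintype.card_fin,
    nsmul_eq_mul, Nat.cast_sub this, Nat.cast_one]

variable {E : ℕ → Type*} [∀ j, NormedAddCommGroup (E j)]

/-- The sequence `u`, whose terms lie in different spaces, is `O(exp (n x))` along `l`. -/
def ExpBounded (l : Filter ℕ) (x : ℝ) (u : ∀ n, E n) : Prop :=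
  (fun n => ‖u n‖) =O[l] fun n => Real.exp x ^ n

/-- The sequence `u`, whose terms lie in different spaces, is `o(exp (n x))` along `l`. -/
def ExpSmall (l : Filter ℕ) (x : ℝ) (u : ∀ n, E n) : Prop :=
  (fun n => ‖u n‖) =o[l] fun n => Real.exp x ^ n

theorem ExpSmall.mono {l l' : Filter ℕ} (hl : l' ≤ l) {x y : ℝ} (hxy : x ≤ y) {u : ∀ n, E n}
    (hl' : l' ≤ atTop) (hu : ExpSmall l x u) : ExpSmall l' y u :=
  (IsLittleO.mono hu hl).trans_isBigO ((isBigO_exp_pow_exp_pow hxy).mono hl')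

theorem ExpBounded.expSmall {l : Filter ℕ} (hl : l ≤ atTop) {x y : ℝ} (hxy : x < y)
    {u : ∀ n, E n} (hu : ExpBounded l x u) : ExpSmall l y u :=
  IsBigO.trans_isLittleO hu ((isLittleO_exp_pow_exp_pow hxy).mono hl)

theorem ExpBounded.of_le {l : Filter ℕ} {x : ℝ} {u : ∀ n, E n} (A : ℝ)
    (h : ∀ᶠ n in l, ‖u n‖ ≤ A * Real.exp x ^ n) : ExpBounded l x u := by
  refine IsBigO.of_bound A (h.mono fun n hn => ?_)
  rwa [norm_norm, Real.norm_of_nonneg (by positivity)]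

theorem ExpSmall.zero (l : Filter ℕ) (x : ℝ) : ExpSmall l x (fun n => (0 : E n)) := by
  simp [ExpSmall]

theorem ExpSmall.add {l : Filter ℕ} {x : ℝ} {u v : ∀ n, E n} (hu : ExpSmall l x u)
    (hv : ExpSmall l x v) : ExpSmall l x (fun n => u n + v n) :=
  IsBigO.trans_isLittleO (IsBigO.of_norm_le fun n => by simpa using norm_add_le (u n) (v n))
    (IsLittleO.add hu hv)

theorem ExpSmall.neg {l : Filter ℕ} {x : ℝ} {u : ∀ n, E n} (hu : ExpSmall l x u) :
    ExpSmall l x (fun n => -u n) := by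
  simpa [ExpSmall] using hu

theorem ExpSmall.sub {l : Filter ℕ} {x : ℝ} {u v : ∀ n, E n} (hu : ExpSmall l x u)
    (hv : ExpSmall l x v) : ExpSmall l x (fun n => u n - v n) := by
  simpa only [sub_eq_add_neg] using hu.add hv.neg

theorem ExpSmall.sum {l : Filter ℕ} {x : ℝ} {α : Type*} {s : Finset α} {u : α → ∀ n, E n}
    (hu : ∀ a ∈ s, ExpSmall l x (u a)) : ExpSmall l x (fun n => ∑ a ∈ s, u a n) := by
  classical
  induction s using Finset.induction_on with
  | empty => simpa using ExpSmall.zero l x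
  | insert a s ha ih =>
    simp_rw [Finset.sum_insert ha]
    exact (hu a (Finset.mem_insert_self a s)).add
      (ih fun b hb => hu b (Finset.mem_insert_of_mem hb))

variable [∀ j, NormedSpace ℝ (E j)]
variable {w : ∀ j, Weight (E j)} {f : ∀ j, E j → E (j + 1)} {ε C : ℝ}

/-- A vector whose images under the linear parts of the iterates are, along a subsequence, too small
for the pointwise lower bound must vanish. -/
theorem eq_zero_of_expSmall_fderiv
    (hlow : ∀ v : E 0, ∃ n₀ : ℕ, ∀ n : ℕ, n₀ ≤ n →
      Real.exp (n * ((w 0).val v - ε)) * ‖v‖ ≤ ‖fderiv ℝ (iterComp f n) 0 v‖)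
    {l : Filter ℕ} [l.NeBot] (hl : l ≤ atTop) {v : E 0} {x : ℝ} (hx : x ≤ (w 0).val v - ε)
    (h : ExpSmall l x fun n => fderiv ℝ (iterComp f n) 0 v) : v = 0 := by
  by_contra hv
  have hpos : 0 < ‖v‖ := norm_pos_iff.2 hv
  obtain ⟨n₀, hn₀⟩ := hlow v
  obtain ⟨n, hn1, hn2⟩ := ((IsLittleO.bound h (half_pos hpos)).and
    ((eventually_ge_atTop n₀).filter_mono hl)).exists
  have h1 := hn₀ n hn2
  rw [norm_norm, Real.norm_of_nonneg (by positivity)] at hn1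
  rw [Real.exp_nat_mul] at h1
  have h2 : Real.exp x ^ n ≤ Real.exp ((w 0).val v - ε) ^ n := by gcongr
  have h3 : 0 < Real.exp ((w 0).val v - ε) ^ n := by positivity
  nlinarith

variable [∀ j, FiniteDimensional ℝ (E j)]

namespace SubresonantCocycle

theorem exists_norm_iterSeries_le_of_le (h : SubresonantCocycle w f ε C) (hε : 0 < ε) {k : ℕ}
    {v : Fin k → E 0} {b : Fin k → ℝ} (hb : ∀ i, v i ∈ (w 0).le (b i)) {x : ℝ}
    (hx : ∑ i, b i + (2 * k - 1) * ε ≤ x) :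
    ∃ A, 0 ≤ A ∧ ∀ n, ‖iterSeries f n k v‖ ≤ A * Real.exp x ^ n := by
  obtain ⟨A, hA0, hA⟩ := h.exists_norm_iterSeries_le hε k v b hb
  exact ⟨A, hA0, fun n => (hA n).trans (by gcongr)⟩

theorem expSmall_iterSeries (h : SubresonantCocycle w f ε C) (hε : 0 < ε) {k : ℕ}
    {v : Fin k → E 0} {b : Fin k → ℝ} (hb : ∀ i, v i ∈ (w 0).le (b i)) {x : ℝ}
    (hx : ∑ i, b i + (2 * k - 1) * ε < x) :
    ExpSmall atTop x fun n => iterSeries f n k v := by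
  obtain ⟨A, -, hA⟩ := h.exists_norm_iterSeries_le_of_le hε hb le_rfl
  exact (ExpBounded.of_le A (.of_forall hA)).expSmall le_rfl hx

/-- The difference of the iterates at two points `a` and `b` is governed by the linear part applied
to `a - b`: in the expansion of the nonlinear part, each term has at least one argument `a - b` and
at least one further argument, which improves the exponent by at least the largest weight `L`. -/
theorem expSmall_iterComp_sub_sub (h : SubresonantCocycle w f ε C) (hε : 0 < ε)
    {a₀ L : ℝ} {D : ℕ} (hB : WeightBounds w a₀ L D) (hD1 : 1 < D)
    (hLε : L + 4 * ε < 0) (a b : E 0) (hab : a ≠ b) :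
    ExpSmall atTop ((w 0).val (a - b) - ε) fun n =>
      iterComp f n a - iterComp f n b - fderiv ℝ (iterComp f n) 0 (a - b) := by
  have hv : a - b ≠ 0 := sub_ne_zero.2 hab
  have hvL : (w 0).val (a - b) ≤ L := hB.le 0 _ ((w 0).val_mem_values hv)
  set v := a - b with hv_def
  have hav : a = b + v := by rw [hv_def]; abel
  have key : ∀ k ∈ Finset.range D, ExpSmall atTop ((w 0).val v - ε) fun n =>
      iterSeries f n k (fun _ => a) - iterSeries f n k (fun _ => b) -
        if k = 1 then iterSeries f n k (fun _ => v) else 0 := by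
    intro k _
    match k with
    | 0 =>
      simpa only [h.iterSeries_zero_coeff, sub_zero, zero_ne_one, if_false] using
        ExpSmall.zero atTop _
    | 1 =>
      simpa only [h.iterSeries_one_eq_fderiv, if_true, hav, map_add, add_sub_cancel_left,
        sub_self] using ExpSmall.zero atTop _
    | k + 2 =>
      have hexp : ∀ n, iterSeries f n (k + 2) (fun _ => a) - iterSeries f n (k + 2) (fun _ => b) -
          (if k + 2 = 1 then iterSeries f n (k + 2) (fun _ => v) else 0) =
          ∑ s ∈ Finset.univ.erase (Finset.univ : Finset (Fin (k + 2))),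
            iterSeries f n (k + 2) (s.piecewise (fun _ => b) fun _ => v) := by
        intro n
        have h1 := (iterSeries f n (k + 2)).map_add_univ (fun _ => b) (fun _ => v)
        rw [← Finset.add_sum_erase _ _ (Finset.mem_univ Finset.univ),
          Finset.piecewise_univ] at h1
        have h2 : ((fun _ => b) + fun _ => v : Fin (k + 2) → E 0) = fun _ => a := by
          ext; simp [hav]
        rw [h2] at h1
        rw [h1, if_neg (by omega)]
        abel
      simp_rw [hexp]
      refine ExpSmall.sum fun s hs => ?_
      obtain ⟨i₀, hi₀⟩ : ∃ i, i ∉ s := by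
        by_contra hcon
        push Not at hcon
        exact Finset.ne_of_mem_erase hs (Finset.eq_univ_iff_forall.2 hcon)
      refine h.expSmall_iterSeries hε
        (b := s.piecewise (fun _ => L) fun _ => (w 0).val v) (fun i => ?_) ?_
      · by_cases hi : i ∈ s
        · simpa [hi] using (w 0).mem_le_of_values_le b (hB.le 0)
        · simpa [hi] using (w 0).mem_le_val v
      · have h3 := sum_le_add_mul_of_le (c := s.piecewise (fun _ => L) fun _ => (w 0).val v)
          (L := L) (x := (w 0).val v) i₀ (by simp [hi₀]) fun i => by
            by_cases hi : i ∈ s <;> simp [hi, hvL]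
        push_cast at h3 ⊢
        nlinarith [(Nat.cast_nonneg k : (0 : ℝ) ≤ k)]
  convert ExpSmall.sum key using 2 with n
  rw [h.iterComp_eq_sum hB, h.iterComp_eq_sum hB, ← Finset.sum_range
    (f := fun k => iterSeries f n k fun _ => a), ← Finset.sum_range
    (f := fun k => iterSeries f n k fun _ => b), Finset.sum_sub_distrib, Finset.sum_sub_distrib,
    Finset.sum_ite_eq', if_pos (Finset.mem_range.2 hD1), h.iterSeries_one_eq_fderiv]

end SubresonantCocycle

/-- The iterates separate points at the slowest possible rate, even along a subsequence. -/
theorem SubresonantCocycle.eq_of_expSmall_iterComp_sub (h : SubresonantCocycle w f ε C)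
    (hε : 0 < ε) {a₀ L : ℝ} {D : ℕ} (hB : WeightBounds w a₀ L D) (hD1 : 1 < D)
    (hLε : L + 4 * ε < 0)
    (hlow : ∀ v : E 0, ∃ n₀ : ℕ, ∀ n : ℕ, n₀ ≤ n →
      Real.exp (n * ((w 0).val v - ε)) * ‖v‖ ≤ ‖fderiv ℝ (iterComp f n) 0 v‖)
    {l : Filter ℕ} [l.NeBot] (hl : l ≤ atTop) {a b : E 0}
    (hab : ExpSmall l (a₀ - ε) fun n => iterComp f n a - iterComp f n b) :
    a = b := by
  by_contra hne
  have hv : a - b ≠ 0 := sub_ne_zero.2 hne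
  have hval : a₀ ≤ (w 0).val (a - b) := hB.ge 0 _ ((w 0).val_mem_values hv)
  refine hv (eq_zero_of_expSmall_fderiv hlow hl le_rfl ?_)
  have h1 := (h.expSmall_iterComp_sub_sub hε hB hD1 hLε a b hne).mono hl le_rfl hl
  have h2 := hab.mono le_rfl (show a₀ - ε ≤ (w 0).val (a - b) - ε by linarith) hl
  simpa only [sub_sub_cancel] using h2.sub h1

end Cocycle

/-! ### Taylor polynomials of functions of class `C^r` -/

section Taylor

open Asymptotics

/-- Taylor's formula for a chain `G 0, G 1, …, G N` of successive derivatives, with the remainder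
bounded by the oscillation of `G N`; this covers Peano, Lipschitz and Hölder remainders at once. -/
theorem norm_sub_taylor_sum_le {F : Type*} [NormedAddCommGroup F] [NormedSpace ℝ F]
    {N : ℕ} {G : ℕ → ℝ → F} {ω : ℝ} (hω : 0 ≤ ω)
    (hG : ∀ k < N, ∀ t ∈ Icc (0 : ℝ) 1, HasDerivAt (G k) (G (k + 1) t) t)
    (hN : ∀ t ∈ Icc (0 : ℝ) 1, ‖G N t - G N 0‖ ≤ ω) (t : ℝ) (ht : t ∈ Icc (0 : ℝ) 1) :
    ‖G 0 t - ∑ k ∈ Finset.range (N + 1), (t ^ k / k.factorial) • G k 0‖ ≤ ω := by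
  induction N generalizing G t with
  | zero => simpa using hN t ht
  | succ N ih =>
    have ih' := ih (G := fun k => G (k + 1)) (fun k hk => hG (k + 1) (by omega)) hN
    set R : ℝ → F := fun t =>
      G 0 t - ∑ k ∈ Finset.range (N + 1 + 1), (t ^ k / k.factorial) • G k 0 with hR
    have hderiv : ∀ t ∈ Icc (0 : ℝ) 1, HasDerivAt R
        (G 1 t - ∑ k ∈ Finset.range (N + 1), (t ^ k / k.factorial) • G (k + 1) 0) t := by
      intro t ht
      refine (hG 0 (by omega) t ht).sub ?_
      simp_rw [Finset.sum_range_succ' _ (N + 1)]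
      simp only [pow_zero, Nat.factorial_zero]
      refine (HasDerivAt.fun_sum fun k _ => ?_).add_const _
      refine HasDerivAt.smul_const ?_ _
      have h1 := (hasDerivAt_pow (k + 1) t).div_const ((k + 1).factorial : ℝ)
      convert! h1 using 1
      rw [Nat.factorial_succ]
      push_cast
      field_simp
    have h0 : R 0 = 0 := by
      simp [hR, Finset.sum_range_succ']
    have h2 := norm_image_sub_le_of_norm_deriv_le_segment' (f := R) (a := 0) (b := 1) (C := ω)
      (fun t ht => (hderiv t ht).hasDerivWithinAt) (fun t ht => ih' t ⟨ht.1, ht.2.le⟩) t ht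
    rw [h0, sub_zero, sub_zero] at h2
    exact h2.trans (mul_le_of_le_one_right hω ht.2)

variable {E : Type*} [NormedAddCommGroup E] [NormedSpace ℝ E]
variable {F : Type*} [NormedAddCommGroup F] [NormedSpace ℝ F]

/-- The Taylor polynomial of degree `N` of `φ` at `0`. -/
def taylorPoly (φ : E → F) (N : ℕ) (x : E) : F :=
  ∑ k ∈ Finset.range (N + 1), polarization φ k (fun _ => x)

theorem norm_sub_taylorPoly_le {φ : E → F} {ρ : ℝ} {N : ℕ}
    (hφ : ContDiffOn ℝ N φ (Metric.ball 0 ρ)) {x : E} (hx : x ∈ Metric.ball (0 : E) ρ) {ω : ℝ}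
    (hω : ∀ y, ‖y‖ ≤ ‖x‖ → ‖iteratedFDeriv ℝ N φ y - iteratedFDeriv ℝ N φ 0‖ ≤ ω) :
    ‖φ x - taylorPoly φ N x‖ ≤ ω * ‖x‖ ^ N := by
  have hω0 : 0 ≤ ω := by simpa using hω 0 (by simp)
  have hxρ : ‖x‖ < ρ := by simpa using hx
  have hle : ∀ t ∈ Icc (0 : ℝ) 1, ‖t • x‖ ≤ ‖x‖ := fun t ht => by
    rw [norm_smul, Real.norm_of_nonneg ht.1]
    exact mul_le_of_le_one_left (norm_nonneg _) ht.2
  have h := norm_sub_taylor_sum_le (N := N) (ω := ω * ‖x‖ ^ N)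
    (G := fun k t => iteratedFDeriv ℝ k φ (t • x) fun _ => x) (by positivity) ?_ ?_ 1 (by simp)
  · convert! h using 2
    simp only [taylorPoly, polarization, smul_apply, one_smul, zero_smul, one_pow, one_div,
      iteratedFDeriv_zero_apply]
  · intro k hk t ht
    have hmem : t • x ∈ Metric.ball (0 : E) ρ := by simpa using (hle t ht).trans_lt hxρ
    have h1 : ContDiffAt ℝ N φ (t • x) := hφ.contDiffAt (Metric.isOpen_ball.mem_nhds hmem)
    have h2 : DifferentiableAt ℝ (iteratedFDeriv ℝ k φ) (t • x) :=
      h1.differentiableAt_iteratedFDeriv (by exact_mod_cast hk)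
    have h3 : HasDerivAt (fun t : ℝ => t • x) x t := by
      simpa using (hasDerivAt_id t).smul_const x
    have h4 := h2.hasFDerivAt.comp_hasDerivAt t h3
    have h5 := ((ContinuousMultilinearMap.apply ℝ (fun _ : Fin k => E) F
      fun _ => x).hasFDerivAt).comp_hasDerivAt t h4
    exact h5
  · intro t ht
    rw [zero_smul, ← sub_apply]
    refine (ContinuousMultilinearMap.le_opNorm _ _).trans ?_
    rw [Finset.prod_const, Finset.card_univ, Fintype.card_fin]
    gcongr
    exact hω _ (hle t ht)

theorem isLittleO_sub_taylorPoly {φ : E → F} {ρ : ℝ} (hρ : 0 < ρ) {N : ℕ}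
    (hφ : ContDiffOn ℝ N φ (Metric.ball 0 ρ)) :
    (fun x => φ x - taylorPoly φ N x) =o[𝓝 0] fun x => ‖x‖ ^ N := by
  have h0 : (0 : E) ∈ Metric.ball (0 : E) ρ := Metric.mem_ball_self hρ
  have hc : ContinuousAt (iteratedFDeriv ℝ N φ) 0 :=
    (hφ.contDiffAt (Metric.isOpen_ball.mem_nhds h0)).continuousAt_iteratedFDeriv le_rfl
  rw [isLittleO_iff]
  intro c hc0
  obtain ⟨δ, hδ, hδc⟩ := Metric.continuousAt_iff.1 hc c hc0
  filter_upwards [Metric.ball_mem_nhds (0 : E) (lt_min hδ hρ)] with x hx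
  have hx' : ‖x‖ < min δ ρ := by simpa using hx
  rw [norm_pow, norm_norm]
  refine norm_sub_taylorPoly_le hφ (by simpa using hx'.trans_le (min_le_right _ _)) fun y hy => ?_
  rw [← dist_eq_norm]
  refine (hδc ?_).le
  simpa using hy.trans_lt (hx'.trans_le (min_le_left _ _))

theorem norm_iteratedFDeriv_le_of_crNorm_le {φ : E → F} {r : ℝ} {U : Set E} {K : ℝ≥0}
    (hK : crNorm r U φ ≤ K) {k : ℕ} (hk : k ≤ ⌊r⌋₊) {x : E} (hx : x ∈ U) :
    ‖iteratedFDeriv ℝ k φ x‖ ≤ K := by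
  have h1 : ‖iteratedFDeriv ℝ k φ x‖ₑ ≤ crNorm r U φ := by
    refine le_trans ?_ le_self_add
    refine le_trans ?_ (le_iSup₂_of_le k (Finset.mem_range.2 (Nat.lt_succ_of_le hk)) le_rfl)
    exact le_iSup₂_of_le x hx le_rfl
  have h2 := h1.trans hK
  rw [enorm_le_coe] at h2
  exact_mod_cast h2

theorem norm_iteratedFDeriv_sub_le_of_crNorm_le {φ : E → F} {r : ℝ} {U : Set E} {K : ℝ≥0}
    (hK : crNorm r U φ ≤ K) (hr : Int.fract r ≠ 0) {x y : E} (hx : x ∈ U) (hy : y ∈ U) :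
    ‖iteratedFDeriv ℝ ⌊r⌋₊ φ x - iteratedFDeriv ℝ ⌊r⌋₊ φ y‖ ≤ K * ‖x - y‖ ^ Int.fract r := by
  have hfr : 0 < Int.fract r := (Int.fract_nonneg r).lt_of_ne' hr
  by_cases hxy : x = y
  · simp [hxy, hr]
  have h1 : edist (iteratedFDeriv ℝ ⌊r⌋₊ φ x) (iteratedFDeriv ℝ ⌊r⌋₊ φ y) /
      edist x y ^ Int.fract r ≤ K := by
    refine le_trans ?_ hK
    rw [crNorm, if_neg hr]
    refine le_trans ?_ le_add_self
    exact le_iSup₂_of_le x hx (le_iSup₂_of_le y hy (le_iSup_of_le hxy le_rfl))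
  have h0 : edist x y ^ Int.fract r ≠ 0 := by
    simp [ENNReal.rpow_eq_zero_iff, hxy, hfr.not_gt]
  have ht : edist x y ^ Int.fract r ≠ ⊤ := ENNReal.rpow_ne_top_of_nonneg hfr.le (edist_ne_top _ _)
  rw [ENNReal.div_le_iff h0 ht] at h1
  rw [edist_dist, edist_dist, ENNReal.ofReal_rpow_of_nonneg dist_nonneg hfr.le,
    ← ENNReal.ofReal_coe_nnreal, ← ENNReal.ofReal_mul K.coe_nonneg,
    ENNReal.ofReal_le_ofReal_iff (by positivity), dist_eq_norm, dist_eq_norm] at h1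
  exact h1

theorem norm_polarization_le_of_crNorm_le {φ : E → F} {r ρ : ℝ} (hρ : 0 < ρ) {K : ℝ≥0}
    (hK : crNorm r (Metric.ball 0 ρ) φ ≤ K) {k : ℕ} (hk : k ≤ ⌊r⌋₊) :
    ‖polarization φ k‖ ≤ K := by
  have h := norm_iteratedFDeriv_le_of_crNorm_le hK hk (Metric.mem_ball_self hρ)
  rw [polarization, norm_smul, norm_inv, Real.norm_natCast]
  have h1 : ((k.factorial : ℝ))⁻¹ ≤ 1 := inv_le_one_of_one_le₀ (by
    exact_mod_cast Nat.one_le_iff_ne_zero.2 k.factorial_ne_zero)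
  exact (mul_le_of_le_one_left (norm_nonneg _) h1).trans h

/-- The Taylor remainder is controlled by the `C^r` norm alone. If `r ≥ N + 1`, the derivative of
order `N` is Lipschitz; otherwise `⌊r⌋ = N` and it is Hölder of exponent `r - N`. -/
theorem norm_sub_taylorPoly_le_of_crNorm_le {φ : E → F} {r ρ : ℝ} {N : ℕ} (hN : (N : ℝ) < r)
    (hφ : IsCr r (Metric.ball 0 ρ) φ) {K : ℝ≥0} (hK : crNorm r (Metric.ball 0 ρ) φ ≤ K)
    {x : E} (hx : x ∈ Metric.ball (0 : E) ρ) :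
    ‖φ x - taylorPoly φ N x‖ ≤ K * ‖x‖ ^ min r (N + 1) := by
  have hr0 : 0 ≤ r := (Nat.cast_nonneg N).trans hN.le
  have hNr : N ≤ ⌊r⌋₊ := Nat.le_floor hN.le
  have hxρ : ‖x‖ < ρ := by simpa using hx
  have h0 : (0 : E) ∈ Metric.ball (0 : E) ρ :=
    Metric.mem_ball_self ((norm_nonneg _).trans_lt hxρ)
  rcases le_or_gt ((N : ℝ) + 1) r with hr | hr
  · have hNr1 : N + 1 ≤ ⌊r⌋₊ := Nat.le_floor (by exact_mod_cast hr)
    rw [min_eq_right hr]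
    have h := norm_sub_taylorPoly_le (N := N) (ω := K * ‖x‖)
      (hφ.1.of_le (by exact_mod_cast hNr)) hx fun y hy => ?_
    · refine h.trans (le_of_eq ?_)
      rw [show ((N : ℝ) + 1) = ((N + 1 : ℕ) : ℝ) by push_cast; ring, Real.rpow_natCast]
      ring
    · have hyb : y ∈ Metric.ball (0 : E) ρ := by simpa using hy.trans_lt hxρ
      have hd : ∀ z ∈ Metric.ball (0 : E) ρ, DifferentiableAt ℝ (iteratedFDeriv ℝ N φ) z :=
        fun z hz => (hφ.1.contDiffAt (Metric.isOpen_ball.mem_nhds hz)).differentiableAt_iteratedFDeriv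
          (by exact_mod_cast hNr1)
      have h1 := (convex_ball (0 : E) ρ).norm_image_sub_le_of_norm_fderiv_le (𝕜 := ℝ) (C := K) hd
        (fun z hz => by
          rw [norm_fderiv_iteratedFDeriv]
          exact norm_iteratedFDeriv_le_of_crNorm_le hK hNr1 hz) h0 hyb
      rw [sub_zero] at h1
      exact h1.trans (by gcongr)
  · have hfl : ⌊r⌋₊ = N := by
      rw [Nat.floor_eq_iff hr0]
      exact ⟨hN.le, hr⟩
    have hfr : Int.fract r = r - N := by
      rw [Int.fract, ← hfl, natCast_floor_eq_intCast_floor hr0]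
    have hfr0 : 0 < Int.fract r := by rw [hfr]; linarith
    rw [min_eq_left hr.le]
    have h := norm_sub_taylorPoly_le (N := N) (ω := K * ‖x‖ ^ Int.fract r)
      (hφ.1.of_le (by exact_mod_cast hNr)) hx fun y hy => ?_
    · refine h.trans (le_of_eq ?_)
      rw [mul_assoc, ← Real.rpow_natCast, ← Real.rpow_add_of_nonneg (norm_nonneg _) hfr0.le
        (Nat.cast_nonneg N), hfr, sub_add_cancel]
    · have hyb : y ∈ Metric.ball (0 : E) ρ := by simpa using hy.trans_lt hxρ
      have h1 := norm_iteratedFDeriv_sub_le_of_crNorm_le hK hfr0.ne' hyb h0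
      rw [hfl, sub_zero] at h1
      exact h1.trans (by gcongr)

end Taylor

/-! ### Vector-valued polynomials in several variables -/

section VecPoly

open Asymptotics

variable {ι : Type*} [Fintype ι]

/-- The monomial `t ^ α`. -/
def monom (t : ι → ℝ) (α : ι → ℕ) : ℝ := ∏ i, t i ^ α i

/-- The degree of a multi-index. -/
def mdeg (α : ι → ℕ) : ℕ := ∑ i, α i

/-- The weight of a multi-index if the variables have weights `b`. -/
def mweight (b : ι → ℝ) (α : ι → ℕ) : ℝ := ∑ i, α i * b i

/-- The multi-index of a single variable. -/
def unitExp [DecidableEq ι] (i : ι) : ι → ℕ := Pi.single i 1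

theorem monom_sum {κ : Type*} (s : Finset κ) (t : ι → ℝ) (α : κ → ι → ℕ) :
    monom t (∑ k ∈ s, α k) = ∏ k ∈ s, monom t (α k) := by
  simp only [monom, Finset.sum_apply]
  rw [Finset.prod_comm]
  simp only [Finset.prod_pow_eq_pow_sum]

theorem monom_unitExp [DecidableEq ι] (t : ι → ℝ) (i : ι) : monom t (unitExp i) = t i := by
  rw [monom, Finset.prod_eq_single i]
  · simp [unitExp]
  · intro j _ hj
    simp [unitExp, hj]
  · simp

theorem monom_one (α : ι → ℕ) : monom (fun _ => 1) α = 1 := by simp [monom]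

theorem monom_smul (τ : ℝ) (t : ι → ℝ) (α : ι → ℕ) :
    monom (τ • t) α = τ ^ mdeg α * monom t α := by
  simp [monom, mdeg, mul_pow, Finset.prod_mul_distrib, Finset.prod_pow_eq_pow_sum]

theorem mdeg_sum {κ : Type*} (s : Finset κ) (α : κ → ι → ℕ) :
    mdeg (∑ k ∈ s, α k) = ∑ k ∈ s, mdeg (α k) := by
  simp only [mdeg, Finset.sum_apply]
  exact Finset.sum_comm

theorem mweight_sum {κ : Type*} (s : Finset κ) (b : ι → ℝ) (α : κ → ι → ℕ) :
    mweight b (∑ k ∈ s, α k) = ∑ k ∈ s, mweight b (α k) := by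
  simp only [mweight, Finset.sum_apply, Nat.cast_sum, Finset.sum_mul]
  exact Finset.sum_comm

theorem mdeg_unitExp [DecidableEq ι] (i : ι) : mdeg (unitExp i) = 1 := by
  simp [mdeg, unitExp]

theorem mweight_unitExp [DecidableEq ι] (b : ι → ℝ) (i : ι) : mweight b (unitExp i) = b i := by
  rw [mweight, Finset.sum_eq_single i]
  · simp [unitExp]
  · intro j _ hj
    simp [unitExp, hj]
  · simp

theorem mdeg_eq_zero {α : ι → ℕ} : mdeg α = 0 ↔ α = 0 := by
  simp [mdeg, funext_iff]

theorem mdeg_lt_of_le_of_ne {α β : ι → ℕ} (h : α ≤ β) (hne : α ≠ β) : mdeg α < mdeg β := by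
  obtain ⟨i, hi⟩ := Function.ne_iff.1 hne
  exact Finset.sum_lt_sum (fun i _ => h i) ⟨i, Finset.mem_univ i, (h i).lt_of_ne hi⟩

theorem mweight_le_mdeg_mul {b : ι → ℝ} {q : ℝ} (hb : ∀ i, b i ≤ q) (α : ι → ℕ) :
    mweight b α ≤ mdeg α * q := by
  rw [mweight, mdeg, Nat.cast_sum, Finset.sum_mul]
  exact Finset.sum_le_sum fun i _ => mul_le_mul_of_nonneg_left (hb i) (Nat.cast_nonneg _)

section Coeff

variable {V : Type*} [NormedAddCommGroup V]
variable {J : Type*} [Fintype J]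

/-- The coefficient of `t ^ β` in the vector-valued polynomial `∑ j, t ^ (e j) • c j`. -/
def vecCoeff (e : J → ι → ℕ) (c : J → V) (β : ι → ℕ) : V := ∑ j with e j = β, c j

/-- If two polynomials have the same coefficients up to degree `N`, their parts of degree at most
`N` have the same value at `(1, …, 1)`. -/
theorem sum_filter_eq_sum_filter_of_vecCoeff_eq {J' : Type*} [Fintype J'] {e : J → ι → ℕ}
    {c : J → V} {e' : J' → ι → ℕ} {c' : J' → V} {N : ℕ}
    (h : ∀ β, mdeg β ≤ N → vecCoeff e c β = vecCoeff e' c' β) :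
    ∑ j with mdeg (e j) ≤ N, c j = ∑ j with mdeg (e' j) ≤ N, c' j := by
  classical
  set s : Finset (ι → ℕ) :=
    (Finset.univ.image e ∪ Finset.univ.image e').filter fun β => mdeg β ≤ N with hs
  have h1 : ∑ j with mdeg (e j) ≤ N, c j = ∑ β ∈ s, vecCoeff e c β := by
    rw [← Finset.sum_fiberwise_of_maps_to (t := s) (g := e) fun j hj => by
      simpa [hs] using hj]
    refine Finset.sum_congr rfl fun β hβ => ?_
    rw [vecCoeff, Finset.filter_filter]
    refine Finset.sum_congr (Finset.filter_congr fun j _ => ?_) fun _ _ => rfl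
    exact ⟨fun h => h.2, fun h => ⟨h ▸ (Finset.mem_filter.1 hβ).2, h⟩⟩
  have h2 : ∑ j with mdeg (e' j) ≤ N, c' j = ∑ β ∈ s, vecCoeff e' c' β := by
    rw [← Finset.sum_fiberwise_of_maps_to (t := s) (g := e') fun j hj => by
      simpa [hs] using hj]
    refine Finset.sum_congr rfl fun β hβ => ?_
    rw [vecCoeff, Finset.filter_filter]
    refine Finset.sum_congr (Finset.filter_congr fun j _ => ?_) fun _ _ => rfl
    exact ⟨fun h => h.2, fun h => ⟨h ▸ (Finset.mem_filter.1 hβ).2, h⟩⟩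
  rw [h1, h2]
  exact Finset.sum_congr rfl fun β hβ => h β (Finset.mem_filter.1 hβ).2

variable [NormedSpace ℝ V]
variable {W : Type*} [NormedAddCommGroup W] [NormedSpace ℝ W]

/-- The vector-valued polynomial `∑ j, t ^ (e j) • c j`; the exponents `e j` need not be
distinct. -/
def vecPoly (e : J → ι → ℕ) (c : J → V) (t : ι → ℝ) : V := ∑ j, monom t (e j) • c j

/-- The exponents of the polynomial obtained by substituting a polynomial with exponents `e` into a
power series of degree less than `D`. -/
def substExp (e : J → ι → ℕ) (D : ℕ) (j : Σ k : Fin D, (Fin k → J)) : ι → ℕ :=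
  ∑ i, e (j.2 i)

/-- The coefficients of the polynomial obtained by substituting a polynomial with coefficients `c`
into the terms of degree less than `D` of the power series `p`. -/
def substCoeff (p : FormalMultilinearSeries ℝ V W) (c : J → V) (D : ℕ)
    (j : Σ k : Fin D, (Fin k → J)) : W :=
  p j.1 fun i => c (j.2 i)

theorem sum_apply_vecPoly (p : FormalMultilinearSeries ℝ V W) (e : J → ι → ℕ) (c : J → V) (D : ℕ)
    (t : ι → ℝ) :
    ∑ k : Fin D, p k (fun _ => vecPoly e c t) =
      vecPoly (substExp e D) (substCoeff p c D) t := by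
  classical
  refine Eq.trans ?_ (Fintype.sum_sigma fun j =>
    monom t (substExp e D j) • substCoeff p c D j).symm
  refine Finset.sum_congr rfl fun k _ => ?_
  simp only [vecPoly]
  rw [ContinuousMultilinearMap.map_sum]
  refine Finset.sum_congr rfl fun a _ => ?_
  rw [ContinuousMultilinearMap.map_smul_univ, substExp, monom_sum]
  rfl

theorem vecPoly_unitExp [DecidableEq ι] (w : ι → V) (t : ι → ℝ) :
    vecPoly unitExp w t = ∑ i, t i • w i := by
  simp [vecPoly, monom_unitExp]

theorem vecPoly_one (e : J → ι → ℕ) (c : J → V) : vecPoly e c (fun _ => 1) = ∑ j, c j := by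
  simp [vecPoly, monom_one]

theorem vecPoly_eq_vecPoly_vecCoeff {J' : Type*} [Fintype J'] {e : J → ι → ℕ} (c : J → V)
    {e' : J' → ι → ℕ} (he' : Function.Injective e') (hcov : ∀ j, ∃ j', e' j' = e j)
    (t : ι → ℝ) : vecPoly e c t = vecPoly e' (fun j' => vecCoeff e c (e' j')) t := by
  classical
  choose s hs using hcov
  simp only [vecPoly, vecCoeff, Finset.smul_sum, Finset.sum_filter]
  rw [Finset.sum_comm]
  refine Finset.sum_congr rfl fun j _ => ?_
  rw [Finset.sum_eq_single (s j)]
  · simp [hs]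
  · intro j' _ hj'
    rw [if_neg fun h => hj' (he' (h.symm.trans (hs j).symm)), smul_zero]
  · simp

/-- A real polynomial which is `o(τ ^ N)` at `0` has no coefficients of degree at most `N`. -/
theorem polynomial_coeff_eq_zero_of_isLittleO {P : Polynomial ℝ} {N : ℕ}
    (h : (fun τ => P.eval τ) =o[𝓝[≠] 0] fun τ => τ ^ N) {k : ℕ} (hk : k ≤ N) :
    P.coeff k = 0 := by
  have key : ∀ m, m ≤ N + 1 → Polynomial.X ^ m ∣ P := by
    intro m
    induction m with
    | zero => simp
    | succ m ih =>
      intro hm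
      obtain ⟨R, hR⟩ := ih (by omega)
      have h1 : (fun τ => R.eval τ) =o[𝓝[≠] 0] fun _ => (1 : ℝ) := by
        have h2 : (fun τ => R.eval τ) =o[𝓝[≠] 0] fun τ : ℝ => τ ^ (N - m) := by
          have h3 := (isBigO_refl (fun τ : ℝ => (τ ^ m)⁻¹) (𝓝[≠] 0)).mul_isLittleO h
          refine h3.congr' ?_ ?_
          · filter_upwards [self_mem_nhdsWithin] with τ hτ
            have : τ ^ m ≠ 0 := pow_ne_zero _ hτ
            rw [hR]
            simp [this]
          · filter_upwards [self_mem_nhdsWithin] with τ hτ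
            have : τ ^ m ≠ 0 := pow_ne_zero _ hτ
            rw [inv_mul_eq_div, div_eq_iff this, ← pow_add]
            congr 1
            omega
        refine h2.trans_isBigO ?_
        have h4 : Tendsto (fun τ : ℝ => τ ^ (N - m)) (𝓝[≠] 0) (𝓝 (0 ^ (N - m))) :=
          ((continuous_pow (N - m)).tendsto 0).mono_left nhdsWithin_le_nhds
        exact h4.isBigO_one ℝ
      rw [isLittleO_one_iff] at h1
      have h5 : Tendsto (fun τ => R.eval τ) (𝓝[≠] 0) (𝓝 (R.eval 0)) :=
        (R.continuous.tendsto 0).mono_left nhdsWithin_le_nhds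
      obtain ⟨R', hR'⟩ := (Polynomial.X_dvd_iff (f := R)).2
        (by rw [Polynomial.coeff_zero_eq_eval_zero]; exact tendsto_nhds_unique h5 h1)
      exact ⟨R', by rw [hR, hR', pow_succ, mul_assoc]⟩
  exact Polynomial.X_pow_dvd_iff.1 (key (N + 1) le_rfl) k (by omega)

theorem sum_filter_mdeg_eq_zero_of_isLittleO {e : J → ι → ℕ} {c : J → ℝ} {N : ℕ}
    (h : vecPoly e c =o[𝓝 0] fun t => ‖t‖ ^ N) {k : ℕ} (hk : k ≤ N) (t : ι → ℝ) :
    ∑ j with mdeg (e j) = k, monom t (e j) * c j = 0 := by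
  set P : Polynomial ℝ :=
    ∑ j, Polynomial.monomial (mdeg (e j)) (monom t (e j) * c j) with hP
  have hcoeff : P.coeff k = ∑ j with mdeg (e j) = k, monom t (e j) * c j := by
    simp [hP, Polynomial.coeff_monomial, Finset.sum_filter]
  rw [← hcoeff]
  refine polynomial_coeff_eq_zero_of_isLittleO (N := N) ?_ hk
  have hlim : Tendsto (fun τ : ℝ => τ • t) (𝓝 0) (𝓝 0) := by
    have : Continuous fun τ : ℝ => τ • t := by fun_prop
    simpa using this.tendsto 0
  have h1 := (h.comp_tendsto hlim).mono (nhdsWithin_le_nhds (s := {0}ᶜ))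
  refine (h1.congr_left fun τ => ?_).trans_isBigO ?_
  · simp only [hP, Function.comp, vecPoly, Polynomial.eval_finsetSum, Polynomial.eval_monomial,
      monom_smul, smul_eq_mul]
    exact Finset.sum_congr rfl fun j _ => by ring
  · refine IsBigO.of_bound (‖t‖ ^ N) (.of_forall fun τ => ?_)
    simp only [Function.comp, norm_smul, norm_pow, norm_mul, norm_norm, mul_pow]
    exact (mul_comm _ _).le

theorem vecCoeff_eq_zero_of_isLittleO_real {e : J → ι → ℕ} {c : J → ℝ} {N : ℕ}
    (h : vecPoly e c =o[𝓝 0] fun t => ‖t‖ ^ N) {β : ι → ℕ} (hβ : mdeg β ≤ N) :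
    vecCoeff e c β = 0 := by
  classical
  set φ : (ι → ℕ) ≃ (ι →₀ ℕ) := Finsupp.equivFunOnFinite.symm with hφ
  set q : MvPolynomial ι ℝ :=
    ∑ j with mdeg (e j) = mdeg β, MvPolynomial.monomial (φ (e j)) (c j) with hq
  have hq0 : q = 0 := by
    refine MvPolynomial.funext fun t => ?_
    rw [map_zero, ← sum_filter_mdeg_eq_zero_of_isLittleO h hβ t, hq, map_sum]
    refine Finset.sum_congr rfl fun j _ => ?_
    rw [MvPolynomial.eval_monomial, mul_comm, monom, Finsupp.prod_fintype _ _ (by simp)]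
    rfl
  have h1 : q.coeff (φ β) = 0 := by rw [hq0, MvPolynomial.coeff_zero]
  rw [hq, MvPolynomial.coeff_sum] at h1
  simp only [MvPolynomial.coeff_monomial, φ.injective.eq_iff] at h1
  rw [Finset.sum_filter] at h1
  rw [vecCoeff, Finset.sum_filter]
  refine Eq.trans (Finset.sum_congr rfl fun j _ => ?_) h1
  by_cases hj : e j = β <;> simp [hj]

theorem vecCoeff_eq_zero_of_isLittleO {e : J → ι → ℕ} {c : J → V} {N : ℕ}
    (h : vecPoly e c =o[𝓝 0] fun t => ‖t‖ ^ N) {β : ι → ℕ} (hβ : mdeg β ≤ N) :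
    vecCoeff e c β = 0 := by
  refine SeparatingDual.eq_zero_of_forall_dual_eq_zero (R := ℝ) fun ℓ => ?_
  have h1 : vecPoly e (fun j => ℓ (c j)) =o[𝓝 0] fun t => ‖t‖ ^ N := by
    refine ((ℓ.isBigO_comp (vecPoly e c) (𝓝 0)).trans_isLittleO h).congr_left fun t => ?_
    simp [vecPoly]
  have h2 := vecCoeff_eq_zero_of_isLittleO_real h1 hβ
  rw [vecCoeff, map_sum]
  exact h2

theorem vecCoeff_eq_vecCoeff_of_isLittleO {J' : Type*} [Fintype J'] {e : J → ι → ℕ} {c : J → V}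
    {e' : J' → ι → ℕ} {c' : J' → V} {N : ℕ}
    (h : (fun t => vecPoly e c t - vecPoly e' c' t) =o[𝓝 0] fun t => ‖t‖ ^ N)
    {β : ι → ℕ} (hβ : mdeg β ≤ N) : vecCoeff e c β = vecCoeff e' c' β := by
  have h1 := vecCoeff_eq_zero_of_isLittleO (e := Sum.elim e e')
    (c := Sum.elim c fun j => -c' j) (N := N) (β := β) (h.congr_left fun t => by
      simp [vecPoly, sub_eq_add_neg]) hβ
  rw [vecCoeff, Finset.sum_filter, Fintype.sum_sum_type] at h1
  rw [vecCoeff, vecCoeff, Finset.sum_filter, Finset.sum_filter, ← sub_eq_zero,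
    sub_eq_add_neg, ← Finset.sum_neg_distrib]
  refine Eq.trans ?_ h1
  congr 1
  refine Finset.sum_congr rfl fun j _ => ?_
  by_cases hj : e' j = β <;> simp [hj]

end Coeff

end VecPoly

/-! ### Subresonance of the Taylor polynomial -/

section Jet

set_option linter.unusedSectionVars false

open Asymptotics

section Coeff

variable {ι : Type*}
variable {X : Type*} [NormedAddCommGroup X] [NormedSpace ℝ X]
variable {Y : Type*} [NormedAddCommGroup Y] [NormedSpace ℝ Y]

/-- An enumeration of multi-indices containing all those of degree at most `N`. -/
def jetExp (N : ℕ) (α : ι → Fin (N + 1)) : ι → ℕ := fun i => α i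

theorem jetExp_injective (N : ℕ) : Function.Injective (jetExp (ι := ι) N) := fun _ _ h =>
  funext fun i => Fin.ext (congrFun h i)

variable [Fintype ι]

theorem exists_jetExp_eq {N : ℕ} {β : ι → ℕ} (hβ : mdeg β ≤ N) : ∃ α, jetExp N α = β := by
  refine ⟨fun i => ⟨β i, ?_⟩, rfl⟩
  have : β i ≤ mdeg β := Finset.single_le_sum (fun _ _ => Nat.zero_le _) (Finset.mem_univ i)
  omega

variable [DecidableEq ι]

/-- The coefficient of `t ^ β` in the Taylor polynomial of degree `N` at `0` of
`t ↦ ψ (∑ i, t i • u i)`. -/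
def jetCoeff (ψ : X → Y) (N : ℕ) (u : ι → X) (β : ι → ℕ) : Y :=
  vecCoeff (substExp unitExp (N + 1)) (substCoeff (taylorSeries ψ) u (N + 1)) β

theorem mdeg_substExp_unitExp {D : ℕ} (j : Σ k : Fin D, (Fin k → ι)) :
    mdeg (substExp unitExp D j) = j.1 := by
  simp [substExp, mdeg_sum, mdeg_unitExp]

theorem mweight_substExp_unitExp (b : ι → ℝ) {D : ℕ} (j : Σ k : Fin D, (Fin k → ι)) :
    mweight b (substExp unitExp D j) = ∑ i, b (j.2 i) := by
  simp [substExp, mweight_sum, mweight_unitExp]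

theorem jetCoeff_eq_zero_of_lt {ψ : X → Y} {N : ℕ} {u : ι → X} {β : ι → ℕ} (hβ : N < mdeg β) :
    jetCoeff ψ N u β = 0 := by
  rw [jetCoeff, vecCoeff, Finset.filter_eq_empty_iff.2, Finset.sum_empty]
  rintro j - rfl
  rw [mdeg_substExp_unitExp] at hβ
  have := j.1.2
  omega

theorem taylorPoly_sum_smul (ψ : X → Y) (N : ℕ) (u : ι → X) (t : ι → ℝ) :
    taylorPoly ψ N (∑ i, t i • u i) =
      vecPoly (jetExp N) (fun α => jetCoeff ψ N u (jetExp N α)) t := by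
  rw [taylorPoly, Finset.sum_range, ← vecPoly_unitExp]
  refine (sum_apply_vecPoly (taylorSeries ψ) unitExp u (N + 1) t).trans ?_
  refine vecPoly_eq_vecPoly_vecCoeff _ (jetExp_injective N) (fun j => exists_jetExp_eq ?_) t
  rw [mdeg_substExp_unitExp]
  have := j.1.2
  omega

/-- The words containing each letter of `Fin k` exactly once are the permutations of `Fin k`. -/
theorem jetCoeff_one {ψ : X → Y} {N k : ℕ} (hk : k ≤ N) (u : Fin k → X) :
    jetCoeff ψ N u (fun _ => 1) =
      ∑ σ : Equiv.Perm (Fin k), polarization ψ k fun i => u (σ i) := by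
  have hexp : ∀ σ : Equiv.Perm (Fin k), ∑ i, unitExp (σ i) = fun _ => 1 := by
    intro σ
    rw [Equiv.sum_comp σ unitExp]
    ext i
    simp [unitExp, Finset.sum_apply, Pi.single_apply]
  symm
  rw [jetCoeff, vecCoeff]
  refine Finset.sum_bij (fun σ _ => ⟨⟨k, by omega⟩, σ⟩) (fun σ _ => ?_) (fun σ _ τ _ h => ?_)
    (fun j hj => ?_) (fun σ _ => rfl)
  · exact Finset.mem_filter.2 ⟨Finset.mem_univ _, hexp σ⟩
  · simpa using h
  · have hj' := (Finset.mem_filter.1 hj).2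
    obtain ⟨⟨m, hm⟩, a⟩ := j
    have hmk : m = k := by
      have h1 := mdeg_substExp_unitExp (⟨⟨m, hm⟩, a⟩ : Σ m : Fin (N + 1), (Fin m → Fin k))
      rw [hj'] at h1
      simpa [mdeg] using h1.symm
    subst hmk
    have hsurj : Function.Surjective a := by
      intro i
      by_contra hi
      push Not at hi
      have h2 := congrFun hj' i
      simp only [substExp, Finset.sum_apply, unitExp] at h2
      rw [Finset.sum_eq_zero fun x _ => by simp [Ne.symm (hi x)]] at h2
      exact zero_ne_one h2
    exact ⟨Equiv.ofBijective a (Finite.injective_iff_surjective.2 hsurj |> fun h => ⟨h, hsurj⟩),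
      Finset.mem_univ _, rfl⟩

end Coeff

variable {V W : ℕ → Type*}
  [∀ j, NormedAddCommGroup (V j)] [∀ j, NormedSpace ℝ (V j)] [∀ j, FiniteDimensional ℝ (V j)]
  [∀ j, NormedAddCommGroup (W j)] [∀ j, NormedSpace ℝ (W j)] [∀ j, FiniteDimensional ℝ (W j)]

/-- The iterates of two subresonant cocycles `f` and `g` are semiconjugated, up to terms of order
higher than `N`, by the Taylor polynomials of degree `N` of `φ 0` and `φ n`, whose coefficients stay
bounded as `n` tends to infinity along the filter `l`. The weights on the spaces `V j` lie between
`a` and `L`, those on the spaces `W j` between `a'` and `q`. The degree `N` is so large that `N + 1`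
arguments contracted at the slowest rate `q` of `g` beat the fastest rate `a` of `f`. -/
structure JetConjugacy (wV : ∀ j, Weight (V j)) (wW : ∀ j, Weight (W j))
    (f : ∀ j, V j → V (j + 1)) (g : ∀ j, W j → W (j + 1)) (φ : ∀ n, W n → V n)
    (ε C K a L a' q : ℝ) (DV DW N : ℕ) (l : Filter ℕ) : Prop where
  eps_pos : 0 < ε
  cocycleV : SubresonantCocycle wV f ε C
  cocycleW : SubresonantCocycle wW g ε C
  boundsV : WeightBounds wV a L DV
  boundsW : WeightBounds wW a' q DW
  one_lt : 1 < DV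
  largeV : L + 4 * ε < 0
  largeW : q + 2 * ε < 0
  degree : (N + 1) * (q + 2 * ε) < a
  lower : ∀ v : V 0, ∃ n₀ : ℕ, ∀ n : ℕ, n₀ ≤ n →
    Real.exp (n * ((wV 0).val v - ε)) * ‖v‖ ≤ ‖fderiv ℝ (iterComp f n) 0 v‖
  le_atTop : l ≤ atTop
  bounded : ∀ᶠ n in l, ∀ k ≤ N, ‖polarization (φ n) k‖ ≤ K
  conj : ∀ᶠ n in l, (fun x => iterComp f n (taylorPoly (φ 0) N x) -
    taylorPoly (φ n) N (iterComp g n x)) =o[𝓝 0] fun x => ‖x‖ ^ N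

namespace JetConjugacy

variable {wV : ∀ j, Weight (V j)} {wW : ∀ j, Weight (W j)}
  {f : ∀ j, V j → V (j + 1)} {g : ∀ j, W j → W (j + 1)} {φ : ∀ n, W n → V n}
  {ε C K a L a' q : ℝ} {DV DW N : ℕ} {l : Filter ℕ}
variable {ι : Type*} [Fintype ι] [DecidableEq ι]

variable (f φ DV N) in
/-- The coefficients of the polynomial `iterComp f n ∘ taylorPoly (φ 0) N` in the variables `t`,
where `x = ∑ i, t i • u i`. -/
def leftCoeff (u : ι → W 0) (n : ℕ)
    (j : Σ k : Fin DV, (Fin k → ι → Fin (N + 1))) : V n :=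
  substCoeff (iterSeries f n) (fun α => jetCoeff (φ 0) N u (jetExp N α)) DV j

variable (g φ DW N) in
/-- The coefficients of the polynomial `taylorPoly (φ n) N ∘ iterComp g n` in the variables `t`,
where `x = ∑ i, t i • u i`. -/
def rightCoeff (u : ι → W 0) (n : ℕ)
    (j : Σ k : Fin (N + 1), (Fin k → Σ k : Fin DW, (Fin k → ι))) : V n :=
  substCoeff (taylorSeries (φ n)) (substCoeff (iterSeries g n) u DW) (N + 1) j

variable (DV N ι) in
/-- The exponents belonging to `leftCoeff`. -/
def leftExp : (Σ k : Fin DV, (Fin k → ι → Fin (N + 1))) → ι → ℕ := substExp (jetExp N) DV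

variable (DW N ι) in
/-- The exponents belonging to `rightCoeff`. -/
def rightExp : (Σ k : Fin (N + 1), (Fin k → Σ k : Fin DW, (Fin k → ι))) → ι → ℕ :=
  substExp (substExp unitExp DW) (N + 1)

theorem vecPoly_leftCoeff (h : JetConjugacy wV wW f g φ ε C K a L a' q DV DW N l)
    (u : ι → W 0) (n : ℕ) (t : ι → ℝ) :
    iterComp f n (taylorPoly (φ 0) N (∑ i, t i • u i)) =
      vecPoly (leftExp DV N ι) (leftCoeff f φ DV N u n) t := by
  rw [h.cocycleV.iterComp_eq_sum h.boundsV, taylorPoly_sum_smul]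
  exact sum_apply_vecPoly _ _ _ _ _

theorem vecPoly_rightCoeff (h : JetConjugacy wV wW f g φ ε C K a L a' q DV DW N l)
    (u : ι → W 0) (n : ℕ) (t : ι → ℝ) :
    taylorPoly (φ n) N (iterComp g n (∑ i, t i • u i)) =
      vecPoly (rightExp DW N ι) (rightCoeff g φ DW N u n) t := by
  rw [h.cocycleW.iterComp_eq_sum h.boundsW, ← vecPoly_unitExp, sum_apply_vecPoly, taylorPoly,
    Finset.sum_range]
  exact sum_apply_vecPoly (taylorSeries (φ n)) _ _ _ _

theorem vecCoeff_left_eq_right (h : JetConjugacy wV wW f g φ ε C K a L a' q DV DW N l)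
    (u : ι → W 0) : ∀ᶠ n in l, ∀ β, mdeg β ≤ N →
      vecCoeff (leftExp DV N ι) (leftCoeff f φ DV N u n) β =
        vecCoeff (rightExp DW N ι) (rightCoeff g φ DW N u n) β := by
  filter_upwards [h.conj] with n hn β hβ
  refine vecCoeff_eq_vecCoeff_of_isLittleO ?_ hβ
  have hc : Continuous fun t : ι → ℝ => ∑ i, t i • u i := by fun_prop
  have hlim : Tendsto (fun t : ι → ℝ => ∑ i, t i • u i) (𝓝 0) (𝓝 0) := by
    simpa using hc.tendsto 0
  refine ((hn.comp_tendsto hlim).congr_left fun t => ?_).trans_isBigO ?_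
  · simp only [Function.comp, h.vecPoly_leftCoeff, h.vecPoly_rightCoeff]
  · refine IsBigO.of_bound ((∑ i, ‖u i‖) ^ N) (.of_forall fun t => ?_)
    simp only [Function.comp, norm_pow, norm_norm]
    rw [← mul_pow]
    refine pow_le_pow_left₀ (norm_nonneg _) ?_ N
    refine (norm_sum_le _ _).trans ?_
    rw [Finset.sum_mul]
    refine Finset.sum_le_sum fun i _ => ?_
    rw [norm_smul, mul_comm]
    gcongr
    exact norm_le_pi_norm t i

theorem expBounded_rightCoeff (h : JetConjugacy wV wW f g φ ε C K a L a' q DV DW N l)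
    {u : ι → W 0} {b : ι → ℝ} (hb : ∀ i, u i ∈ (wW 0).le (b i))
    (j : Σ k : Fin (N + 1), (Fin k → Σ k : Fin DW, (Fin k → ι))) (hj : rightExp DW N ι j ≠ 0) :
    ExpBounded l (mweight b (rightExp DW N ι j) + (2 * mdeg (rightExp DW N ι j) - 1) * ε)
      fun n => rightCoeff g φ DW N u n j := by
  obtain ⟨⟨m, hm⟩, s⟩ := j
  have hm1 : (1 : ℝ) ≤ m := by
    rcases Nat.eq_zero_or_pos m with rfl | hpos
    · exact absurd (by simp [rightExp, substExp]) hj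
    · exact_mod_cast hpos
  choose A hA0 hA using fun i => h.cocycleW.exists_norm_iterSeries_le h.eps_pos
    (s i).1 (fun x => u ((s i).2 x)) (fun x => b ((s i).2 x)) fun x => hb _
  refine ExpBounded.of_le (K * ∏ i, A i) ?_
  filter_upwards [h.bounded] with n hn
  have hK : 0 ≤ K := (norm_nonneg _).trans (hn m (by omega))
  calc ‖rightCoeff g φ DW N u n ⟨⟨m, hm⟩, s⟩‖
      ≤ ‖polarization (φ n) m‖ * ∏ i, ‖substCoeff (iterSeries g n) u DW (s i)‖ :=
        ContinuousMultilinearMap.le_opNorm _ _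
    _ ≤ K * ∏ i, (A i * Real.exp (∑ x, b ((s i).2 x) + (2 * ((s i).1 : ℕ) - 1) * ε) ^ n) := by
        gcongr with i
        · exact hn m (by omega)
        · exact hA i n
    _ = (K * ∏ i, A i) *
        Real.exp (∑ i, (∑ x, b ((s i).2 x) + (2 * ((s i).1 : ℕ) - 1) * ε)) ^ n := by
        rw [Finset.prod_mul_distrib, Finset.prod_pow, Real.exp_sum]
        ring
    _ ≤ _ := by
        have hprod : 0 ≤ ∏ i, A i := Finset.prod_nonneg fun i _ => hA0 i
        gcongr
        rw [Finset.sum_add_distrib, ← Finset.sum_mul, Finset.sum_sub_distrib, ← Finset.mul_sum,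
          rightExp, substExp, mweight_sum, mdeg_sum]
        simp only [mweight_substExp_unitExp, mdeg_substExp_unitExp]
        push_cast
        simp only [Finset.sum_const, Finset.card_univ, Fintype.card_fin, nsmul_eq_mul, mul_one]
        nlinarith [h.eps_pos]

theorem leftCoeff_mem_le (h : JetConjugacy wV wW f g φ ε C K a L a' q DV DW N l)
    {u : ι → W 0} {b : ι → ℝ}
    (hjet : ∀ β, jetCoeff (φ 0) N u β ∈ (wV 0).le (mweight b β)) (n : ℕ)
    (j : Σ k : Fin DV, (Fin k → ι → Fin (N + 1))) :
    leftCoeff f φ DV N u n j ∈ (wV n).le (mweight b (leftExp DV N ι j)) := by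
  rw [leftExp, substExp, mweight_sum]
  exact h.cocycleV.iterSeries_mem_le n _ _ _ fun i => hjet _

/-- Suppose the coefficients of degree less than that of `β` are subresonant. If the coefficient of
`t ^ β` is not, then all contributions to the coefficient of `t ^ β` of
`iterComp f n ∘ taylorPoly (φ 0) N` are small compared to the one from the linear part of
`iterComp f n`: those which involve the coefficient of `t ^ β` also involve another one, and those
which do not are controlled by the weight of `β`. -/
theorem expSmall_leftCoeff (h : JetConjugacy wV wW f g φ ε C K a L a' q DV DW N l)
    {u : ι → W 0} {b : ι → ℝ} {β : ι → ℕ} (hβN : mdeg β ≤ N)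
    (hlt : ∀ α, α ≠ 0 → mdeg α < mdeg β → jetCoeff (φ 0) N u α ∈ (wV 0).le (mweight b α))
    (hne : jetCoeff (φ 0) N u β ≠ 0)
    (hgap : mweight b β + 2 * N * ε < (wV 0).val (jetCoeff (φ 0) N u β))
    (j : Σ k : Fin DV, (Fin k → ι → Fin (N + 1))) (hj : leftExp DV N ι j = β)
    (hj1 : (j.1 : ℕ) ≠ 1) :
    ExpSmall atTop ((wV 0).val (jetCoeff (φ 0) N u β) - ε)
      fun n => leftCoeff f φ DV N u n j := by
  have hε := h.eps_pos
  obtain ⟨⟨m, hm⟩, s⟩ := j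
  set x := (wV 0).val (jetCoeff (φ 0) N u β) with hx
  have hxL : x ≤ L := h.boundsV.le 0 _ ((wV 0).val_mem_values hne)
  simp only [ne_eq] at hj1
  by_cases hex : ∃ i₀, jetExp N (s i₀) = β
  · obtain ⟨i₀, hi₀⟩ := hex
    have hm2 : (2 : ℝ) ≤ m := by
      have : 2 ≤ m := by have := i₀.2; simp only at this; omega
      exact_mod_cast this
    refine h.cocycleV.expSmall_iterSeries hε (b := fun i => if i = i₀ then x else L)
      (fun i => ?_) ?_
    · by_cases hi : i = i₀
      · simpa [hi, hi₀] using (wV 0).mem_le_val (jetCoeff (φ 0) N u β)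
      · simpa [hi] using (wV 0).mem_le_of_values_le _ (h.boundsV.le 0)
    · have h1 := sum_le_add_mul_of_le (c := fun i => if i = i₀ then x else L) (x := x) (L := L)
        i₀ (by simp) fun i => by by_cases hi : i = i₀ <;> simp [hi, hxL]
      simp only at h1 ⊢
      nlinarith [h.largeV]
  · push Not at hex
    have hle : ∀ i, jetExp N (s i) ≤ β := by
      intro i
      rw [← hj, leftExp, substExp]
      exact Finset.single_le_sum (f := fun i => jetExp N (s i)) (fun _ _ => fun _ => Nat.zero_le _)
        (Finset.mem_univ i)
    refine h.cocycleV.expSmall_iterSeries hε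
      (b := fun i => if jetExp N (s i) = 0 then L else mweight b (jetExp N (s i)))
      (fun i => ?_) ?_
    · by_cases hi : jetExp N (s i) = 0
      · simpa [hi] using (wV 0).mem_le_of_values_le _ (h.boundsV.le 0)
      · simpa [hi] using hlt _ hi (mdeg_lt_of_le_of_ne (hle i) (hex i))
    · have h1 : ∑ i, ((if jetExp N (s i) = 0 then L else mweight b (jetExp N (s i))) + 2 * ε) ≤
          ∑ i, (mweight b (jetExp N (s i)) + mdeg (jetExp N (s i)) * (2 * ε)) := by
        refine Finset.sum_le_sum fun i _ => ?_
        by_cases hi : jetExp N (s i) = 0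
        · rw [if_pos hi, hi]
          simp only [mweight, mdeg, Pi.zero_apply]
          simp
          linarith [h.largeV]
        · rw [if_neg hi]
          have h2 : (1 : ℝ) ≤ mdeg (jetExp N (s i)) := by
            exact_mod_cast Nat.one_le_iff_ne_zero.2 (mdeg_eq_zero.not.2 hi)
          nlinarith
      have h3 : ∑ i, mweight b (jetExp N (s i)) = mweight b β := by
        rw [← mweight_sum, ← hj]; rfl
      have h4 : ∑ i, (mdeg (jetExp N (s i)) : ℝ) = mdeg β := by
        rw [← Nat.cast_sum, ← mdeg_sum, ← hj]; rfl
      have h6 : ∑ i, (mdeg (jetExp N (s i)) : ℝ) * (2 * ε) = mdeg β * (2 * ε) := by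
        rw [← Finset.sum_mul, h4]
      rw [Finset.sum_add_distrib, Finset.sum_add_distrib, h3, h6] at h1
      simp only [Finset.sum_const, Finset.card_univ, Fintype.card_fin, nsmul_eq_mul] at h1 ⊢
      have h5 : (mdeg β : ℝ) ≤ N := by exact_mod_cast hβN
      nlinarith

theorem leftCoeff_eq_fderiv (h : JetConjugacy wV wW f g φ ε C K a L a' q DV DW N l)
    (u : ι → W 0) (n : ℕ) (α : ι → Fin (N + 1)) :
    leftCoeff f φ DV N u n ⟨⟨1, h.one_lt⟩, fun _ => α⟩ =
      fderiv ℝ (iterComp f n) 0 (jetCoeff (φ 0) N u (jetExp N α)) :=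
  h.cocycleV.iterSeries_one_eq_fderiv n _

theorem jetCoeff_mem_le [l.NeBot] (h : JetConjugacy wV wW f g φ ε C K a L a' q DV DW N l)
    {u : ι → W 0} {b : ι → ℝ} (hb : ∀ i, u i ∈ (wW 0).le (b i))
    (hgap : ∀ β : ι → ℕ, β ≠ 0 → mdeg β ≤ N → ∀ v : V 0, v ≠ 0 →
      mweight b β < (wV 0).val v → mweight b β + 2 * N * ε < (wV 0).val v)
    (β : ι → ℕ) (hβ : β ≠ 0) : jetCoeff (φ 0) N u β ∈ (wV 0).le (mweight b β) := by
  have hε := h.eps_pos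
  induction hd : mdeg β using Nat.strong_induction_on generalizing β with
  | _ d ih =>
    subst hd
    rcases lt_or_ge N (mdeg β) with hN | hN
    · rw [jetCoeff_eq_zero_of_lt hN]
      exact Submodule.zero_mem _
    by_contra hnot
    have hne : jetCoeff (φ 0) N u β ≠ 0 := fun h0 => hnot (h0 ▸ Submodule.zero_mem _)
    have hval : mweight b β < (wV 0).val (jetCoeff (φ 0) N u β) :=
      not_le.1 fun hle => hnot (((wV 0).mem_le_iff hne).2 hle)
    have hval' := hgap β hβ hN _ hne hval
    obtain ⟨α, hα⟩ := exists_jetExp_eq hN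
    set j₀ : Σ k : Fin DV, (Fin k → ι → Fin (N + 1)) := ⟨⟨1, h.one_lt⟩, fun _ => α⟩
    have hj₀β : leftExp DV N ι j₀ = β := (Fin.sum_univ_one fun _ => jetExp N α).trans hα
    have hleft : ∀ j ∈ (Finset.univ.filter fun j => leftExp DV N ι j = β).erase j₀,
        ExpSmall l ((wV 0).val (jetCoeff (φ 0) N u β) - ε)
          fun n => leftCoeff f φ DV N u n j := by
      intro j hj
      have hjβ := (Finset.mem_filter.1 (Finset.mem_of_mem_erase hj)).2
      refine (h.expSmall_leftCoeff hN (fun α hα0 hαlt => ih _ hαlt α hα0 rfl) hne hval' j hjβ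
        fun h1 => Finset.ne_of_mem_erase hj ?_).mono h.le_atTop le_rfl h.le_atTop
      obtain ⟨⟨m, hm⟩, s⟩ := j
      simp only at h1
      subst h1
      have hs : s = fun _ => α := by
        funext i
        refine jetExp_injective N ?_
        rw [hα, ← hjβ, Subsingleton.elim i 0]
        simp [leftExp, substExp]
      rw [hs]
    have hright : ∀ j ∈ Finset.univ.filter fun j => rightExp DW N ι j = β,
        ExpSmall l ((wV 0).val (jetCoeff (φ 0) N u β) - ε)
          fun n => rightCoeff g φ DW N u n j := by
      intro j hj
      have hjβ := (Finset.mem_filter.1 hj).2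
      refine (h.expBounded_rightCoeff hb j (hjβ ▸ hβ)).expSmall h.le_atTop ?_
      rw [hjβ]
      have h5 : (mdeg β : ℝ) ≤ N := by exact_mod_cast hN
      nlinarith
    refine hne (eq_zero_of_expSmall_fderiv h.lower h.le_atTop le_rfl ?_)
    refine IsLittleO.congr' ((ExpSmall.sum hright).sub (ExpSmall.sum hleft)) ?_ EventuallyEq.rfl
    filter_upwards [h.vecCoeff_left_eq_right u] with n hn
    have h6 := hn β hN
    rw [vecCoeff, vecCoeff, ← Finset.add_sum_erase _ _ (Finset.mem_filter.2
      ⟨Finset.mem_univ j₀, hj₀β⟩), h.leftCoeff_eq_fderiv, hα] at h6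
    rw [← h6, add_sub_cancel_right]

theorem expSmall_iterComp_taylorPoly_sub
    (h : JetConjugacy wV wW f g φ ε C K a L a' q DV DW N l)
    {u : ι → W 0} {b : ι → ℝ} (hb : ∀ i, u i ∈ (wW 0).le (b i)) (hbq : ∀ i, b i ≤ q)
    (hjet : ∀ β, β ≠ 0 → jetCoeff (φ 0) N u β ∈ (wV 0).le (mweight b β)) :
    ExpSmall l (a - ε) fun n => iterComp f n (taylorPoly (φ 0) N (∑ i, u i)) -
      taylorPoly (φ n) N (iterComp g n (∑ i, u i)) := by
  have hε := h.eps_pos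
  have hbound : ∀ β : ι → ℕ, N < mdeg β → mweight b β + 2 * mdeg β * ε < a := by
    intro β hβ
    have h1 := mweight_le_mdeg_mul hbq β
    have h2 : (N : ℝ) + 1 ≤ mdeg β := by exact_mod_cast hβ
    nlinarith [h.degree, h.largeW]
  have hjet' : ∀ β, jetCoeff (φ 0) N u β ∈ (wV 0).le (mweight b β) := by
    intro β
    by_cases hβ : β = 0
    · refine (wV 0).le_mono ?_ ((wV 0).mem_le_of_values_le _ (h.boundsV.le 0))
      simp only [hβ, mweight, Pi.zero_apply, Nat.cast_zero, zero_mul, Finset.sum_const_zero]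
      linarith [h.largeV]
    · exact hjet β hβ
  have hleft : ∀ n j, N < mdeg (leftExp DV N ι j) → leftCoeff f φ DV N u n j = 0 := by
    intro n j hj
    refine (wV n).eq_zero_of_mem_le (h.boundsV.ge n) ?_ (h.leftCoeff_mem_le hjet' n j)
    have := hbound _ hj
    have h3 : (0 : ℝ) ≤ mdeg (leftExp DV N ι j) := Nat.cast_nonneg _
    nlinarith
  have hright : ∀ j ∈ Finset.univ.filter fun j => ¬ mdeg (rightExp DW N ι j) ≤ N,
      ExpSmall l (a - ε) fun n => rightCoeff g φ DW N u n j := by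
    intro j hj
    have hjN := not_le.1 (Finset.mem_filter.1 hj).2
    refine (h.expBounded_rightCoeff hb j ?_).expSmall h.le_atTop ?_
    · intro h0
      rw [mdeg_eq_zero.2 h0] at hjN
      exact Nat.not_lt_zero _ hjN
    · linarith [hbound _ hjN]
  refine IsLittleO.congr' (ExpSmall.sum hright).neg ?_ EventuallyEq.rfl
  filter_upwards [h.vecCoeff_left_eq_right u] with n hn
  have h1 := h.vecPoly_leftCoeff u n fun _ => 1
  have h2 := h.vecPoly_rightCoeff u n fun _ => 1
  simp only [one_smul, vecPoly_one] at h1 h2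
  rw [h1, h2, ← Finset.sum_filter_add_sum_filter_not Finset.univ
      (fun j => mdeg (leftExp DV N ι j) ≤ N),
    ← Finset.sum_filter_add_sum_filter_not Finset.univ (fun j => mdeg (rightExp DW N ι j) ≤ N)
      (rightCoeff g φ DW N u n), sum_filter_eq_sum_filter_of_vecCoeff_eq hn,
    Finset.sum_eq_zero fun j hj => hleft n j (not_le.1 (Finset.mem_filter.1 hj).2)]
  congr 1
  abel

end JetConjugacy

end Jet

/-! ### From the Taylor polynomial to the function -/

section Main

open Asymptotics

theorem mul_lt_of_floor_div_lt {a L : ℝ} (hL : L < 0) {k : ℕ} (hk : ⌊a / L⌋₊ + 1 ≤ k) :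
    k * L < a := by
  have h1 : a / L < k := (Nat.lt_floor_add_one _).trans_le (by exact_mod_cast hk)
  rwa [div_lt_iff_of_neg hL] at h1

theorem WeightBounds.of_values_eq_range {E : ℕ → Type*} [∀ j, NormedAddCommGroup (E j)]
    [∀ j, NormedSpace ℝ (E j)] {w : ∀ j, Weight (E j)} {m : ℕ} {v : Fin (m + 1) → ℝ}
    (hv : StrictMono v) (hneg : v (Fin.last m) < 0) (h : ∀ j, (w j).values = Set.range v) :
    WeightBounds w (v 0) (v (Fin.last m)) (⌊v 0 / v (Fin.last m)⌋₊ + 1) := by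
  refine ⟨fun j c hc => ?_, fun j c hc => ?_, fun k hk => mul_lt_of_floor_div_lt hneg hk⟩
  · rw [h j] at hc
    obtain ⟨i, rfl⟩ := hc
    exact hv.monotone (Fin.le_last i)
  · rw [h j] at hc
    obtain ⟨i, rfl⟩ := hc
    exact hv.monotone (Fin.zero_le i)

/-- A multi-index of degree `k` is the list of multiplicities of a word of length `k`. -/
theorem exists_word_mweight {ι : Type*} [Fintype ι] (β : ι → ℕ) :
    ∃ s : Fin (mdeg β) → ι, ∀ b : ι → ℝ, ∑ m, b (s m) = mweight b β := by
  have e : (Σ i, Fin (β i)) ≃ Fin (mdeg β) := Fintype.equivFinOfCardEq (by simp [mdeg])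
  refine ⟨fun m => (e.symm m).1, fun b => ?_⟩
  rw [Equiv.sum_comp e.symm fun x : Σ i, Fin (β i) => b x.1, Fintype.sum_sigma]
  simp [mweight]

section TaylorPoly

variable {X : Type*} [NormedAddCommGroup X] [NormedSpace ℝ X]
variable {Y : Type*} [NormedAddCommGroup Y] [NormedSpace ℝ Y]

theorem taylorPoly_zero (ψ : X → Y) (N : ℕ) : taylorPoly ψ N 0 = ψ 0 := by
  rw [taylorPoly, Finset.sum_range_succ', Finset.sum_eq_zero fun k _ => ?_, zero_add,
    polarization_zero_apply]
  exact (polarization ψ (k + 1)).map_coord_zero 0 rfl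

theorem continuous_taylorPoly (ψ : X → Y) (N : ℕ) : Continuous (taylorPoly ψ N) :=
  continuous_finsetSum _ fun k _ => (polarization ψ k).cont.comp (by fun_prop)

/-- Polynomials replacing `φ` and `ψ` in a semiconjugacy: an error of order higher than `N` on both
sides. -/
theorem isLittleO_taylorPoly_conj {X' Y' : Type*} [NormedAddCommGroup X'] [NormedSpace ℝ X']
    [NormedAddCommGroup Y'] [NormedSpace ℝ Y'] {φ : X → Y} {ψ : X' → Y'} {F : Y → Y'} {G : X → X'}
    {ρ : ℝ} (hρ : 0 < ρ) {N : ℕ} (hφ : ContDiffOn ℝ N φ (Metric.ball 0 ρ))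
    (hψ : ContDiffOn ℝ N ψ (Metric.ball 0 ρ)) {F' : Y →L[ℝ] Y'} (hF : HasStrictFDerivAt F F' (φ 0))
    (hG : DifferentiableAt ℝ G 0) (hG0 : G 0 = 0)
    (h : ∀ x ∈ Metric.ball (0 : X) ρ, G x ∈ Metric.ball (0 : X') ρ → F (φ x) = ψ (G x)) :
    (fun x => F (taylorPoly φ N x) - taylorPoly ψ N (G x)) =o[𝓝 0] fun x => ‖x‖ ^ N := by
  have h0 : (0 : X) ∈ Metric.ball (0 : X) ρ := Metric.mem_ball_self hρ
  have hφc : ContinuousAt φ 0 := (hφ.contDiffAt (Metric.isOpen_ball.mem_nhds h0)).continuousAt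
  have hGc : Tendsto G (𝓝 0) (𝓝 0) := by simpa [hG0] using hG.continuousAt.tendsto
  have hT : Tendsto (taylorPoly φ N) (𝓝 0) (𝓝 (φ 0)) := by
    simpa [taylorPoly_zero] using (continuous_taylorPoly φ N).tendsto 0
  have h1 : (fun x => F (φ x) - F (taylorPoly φ N x)) =o[𝓝 0] fun x => ‖x‖ ^ N :=
    (hF.isBigO_sub.comp_tendsto (hφc.tendsto.prodMk_nhds hT)).trans_isLittleO
      (isLittleO_sub_taylorPoly hρ hφ)
  have h2 : (fun x => ψ (G x) - taylorPoly ψ N (G x)) =o[𝓝 0] fun x => ‖x‖ ^ N := by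
    refine ((isLittleO_sub_taylorPoly hρ hψ).comp_tendsto hGc).trans_isBigO ?_
    have h3 : G =O[𝓝 0] fun x => x := by simpa [hG0] using hG.isBigO_sub
    exact h3.norm_norm.pow N
  refine (h2.sub h1).congr' ?_ EventuallyEq.rfl
  filter_upwards [Metric.ball_mem_nhds (0 : X) hρ, hGc (Metric.ball_mem_nhds (0 : X') hρ)]
    with x hx hGx
  rw [h x hx hGx]
  abel

theorem isSubresonant_taylorPoly [CompleteSpace Y] {wX : Weight X} {wY : Weight Y} {ψ : X → Y}
    {N : ℕ} (h : ∀ k ≤ N, ∀ v : Fin k → X, (∀ i, v i ≠ 0) →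
      jetCoeff ψ N v (fun _ => 1) ∈ wY.le (∑ i, wX.val (v i))) :
    IsSubresonant wX wY (taylorPoly ψ N) := by
  refine ⟨⟨N, fun k => polarization ψ k, fun x => rfl⟩, (polyWeight_nonpos_iff _ _ _).2 ?_⟩
  intro k v hv
  have h1 := polarization_sum_apply (N + 1) (fun k => polarization ψ k) k v
  refine (congrArg (· ∈ wY.le (∑ i, wX.val (v i))) h1).mpr (Submodule.smul_mem _ _ ?_)
  split_ifs with hk
  · rw [← jetCoeff_one (show k ≤ N by omega)]
    exact h k (by omega) v hv
  · exact Submodule.zero_mem _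

end TaylorPoly

variable {E : ℕ → Type*} [∀ j, NormedAddCommGroup (E j)] [∀ j, NormedSpace ℝ (E j)]
  [∀ j, FiniteDimensional ℝ (E j)]

theorem SubresonantCocycle.expSmall_iterComp {w : ∀ j, Weight (E j)} {f : ∀ j, E j → E (j + 1)}
    {ε C a L : ℝ} {D : ℕ} (h : SubresonantCocycle w f ε C) (hε : 0 < ε)
    (hB : WeightBounds w a L D) (hL : L + 2 * ε < 0) (x : E 0) :
    ExpSmall atTop (L + 2 * ε) fun n => iterComp f n x := by
  simp_rw [h.iterComp_eq_sum hB]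
  refine ExpSmall.sum fun k _ => ?_
  rcases Nat.eq_zero_or_pos (k : ℕ) with hk | hk
  · obtain ⟨k, hkD⟩ := k
    simp only at hk
    subst hk
    simpa only [h.iterSeries_zero_coeff] using ExpSmall.zero atTop _
  · refine h.expSmall_iterSeries hε (b := fun _ => L)
      (fun i => (w 0).mem_le_of_values_le _ (hB.le 0)) ?_
    have hk1 : (1 : ℝ) ≤ (k : ℕ) := by exact_mod_cast hk
    simp only [Finset.sum_const, Finset.card_univ, Fintype.card_fin, nsmul_eq_mul]
    nlinarith

end Main

end Subres

end

open Subres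

theorem proposition2p5
    {l p : ℕ} (lam : Fin (l + 1) → ℝ) (eta : Fin (p + 1) → ℝ)
    (hlam : StrictMono lam) (hlam_neg : lam (Fin.last l) < 0)
    (heta : StrictMono eta) (heta_neg : eta (Fin.last p) < 0)
    (V W : ℕ → Type*)
    [∀ j, NormedAddCommGroup (V j)] [∀ j, NormedSpace ℝ (V j)] [∀ j, FiniteDimensional ℝ (V j)]
    [∀ j, NormedAddCommGroup (W j)] [∀ j, NormedSpace ℝ (W j)] [∀ j, FiniteDimensional ℝ (W j)]
    (wV : ∀ j, Subres.Weight (V j)) (wW : ∀ j, Subres.Weight (W j))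
    (hV_values : ∀ j, (wV j).values = Set.range lam)
    (hV_compat : ∀ i j, (wV i).Compatible (wV j))
    (hW_values : ∀ j, (wW j).values = Set.range eta)
    (hW_compat : ∀ i j, (wW i).Compatible (wW j))
    (f : ∀ j, V j → V (j + 1)) (g : ∀ j, W j → W (j + 1))
    (hf : ∀ j, Subres.IsInvertibleSubresonant (wV j) (wV (j + 1)) (f j))
    (hg : ∀ j, Subres.IsInvertibleSubresonant (wW j) (wW (j + 1)) (g j))
    (hf_zero : ∀ j, f j 0 = 0) (hg_zero : ∀ j, g j 0 = 0)
    (r : ℝ) (hr : lam 0 / eta (Fin.last p) < r)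
    (ε : ℝ) (hε : Subres.AdmissibleEps lam eta r ε)
    (hf_lin : ∀ j v, ‖fderiv ℝ (f j) 0 v‖ ≤ Real.exp ((wV j).val v + ε) * ‖v‖)
    (hg_lin : ∀ j w, ‖fderiv ℝ (g j) 0 w‖ ≤ Real.exp ((wW j).val w + ε) * ‖w‖)
    (C : ℝ)
    (hf_norm : ∀ j : ℕ, Subres.polyNorm (f j) ≤ C * Real.exp (ε * j))
    (hg_norm : ∀ j : ℕ, Subres.polyNorm (g j) ≤ C * Real.exp (ε * j))
    (hf_lower : ∀ v : V 0, ∃ n₀ : ℕ, ∀ n : ℕ, n₀ ≤ n →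
      Real.exp (n * ((wV 0).val v - ε)) * ‖v‖ ≤ ‖fderiv ℝ (Subres.iterComp f n) 0 v‖)
    (ρ : ℝ) (hρ : 0 < ρ)
    (φ : ∀ n, W n → V n)
    (hφ : ∀ n, Subres.IsCr r (Metric.ball 0 ρ) (φ n))
    (hφ_eq : ∀ (n : ℕ) (x : W 0), x ∈ Metric.ball (0 : W 0) ρ →
      Subres.iterComp g n x ∈ Metric.ball (0 : W n) ρ →
      Subres.iterComp f n (φ 0 x) = φ n (Subres.iterComp g n x))
    (S : Set ℕ) (hS : S.Infinite)
    (hφ_bdd : ⨆ n ∈ S, Subres.crNorm r (Metric.ball 0 ρ) (φ n) < ⊤) :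
    ∃ h : W 0 → V 0, Subres.IsSubresonant (wW 0) (wV 0) h ∧
      ∀ x ∈ Metric.ball (0 : W 0) ρ, φ 0 x = h x := by
  have hcompleteV : ∀ j, CompleteSpace (V j) := fun j => FiniteDimensional.complete ℝ (V j)
  set a := lam 0 with ha
  set L := lam (Fin.last l) with hL
  set q := eta (Fin.last p) with hq
  set N := d2 lam eta with hN
  set s := sExp lam eta r with hs
  have hε0 : 0 < ε := hε.pos
  have haL : a ≤ L := hlam.monotone (Fin.zero_le _)
  have ha0 : a < 0 := haL.trans_lt hlam_neg
  have haq : 0 < a / q := div_pos_of_neg_of_neg ha0 heta_neg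
  have hNr : (N : ℝ) < r := (Nat.floor_le haq.le).trans_lt hr
  have hNfloor : N ≤ ⌊r⌋₊ := Nat.le_floor hNr.le
  have hs_le : s ≤ N + 1 := min_le_right _ _
  have hs0 : 0 < s := lt_min (haq.trans hr) (by positivity)
  have hd1 : 1 ≤ d1 lam := Nat.le_floor (by
    rw [Nat.cast_one, le_div_iff_of_neg hlam_neg, one_mul]; exact haL)
  have hdmax : (1 : ℝ) ≤ dmax lam eta := by exact_mod_cast hd1.trans (le_max_left _ _)
  have hNd : (N : ℝ) ≤ dmax lam eta := by
    exact_mod_cast (le_max_left _ _).trans (le_max_right _ _)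
  -- `10 d ε` is smaller than `-λ_ℓ` and `-η_p`, where `d ≥ 1`.
  have hLε : L + 10 * ε < 0 := by nlinarith [hε.lt_lam]
  have hqε : q + 10 * ε < 0 := by nlinarith [hε.lt_eta]
  have hsε : s * (q + 3 * ε) < a - 2 * ε := by
    have := hε.lt_reg
    rw [lt_div_iff₀ (by positivity)] at this
    linarith
  have hBV : WeightBounds wV a L (d1 lam + 1) :=
    WeightBounds.of_values_eq_range hlam hlam_neg hV_values
  have hBW : WeightBounds wW (eta 0) q (d3 eta + 1) :=
    WeightBounds.of_values_eq_range heta heta_neg hW_values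
  have hcV : SubresonantCocycle wV f ε C := ⟨fun j => (hf j).1, hf_zero, hf_lin, hf_norm⟩
  have hcW : SubresonantCocycle wW g ε C := ⟨fun j => (hg j).1, hg_zero, hg_lin, hg_norm⟩
  obtain ⟨K, hK⟩ : ∃ K : NNReal, ∀ n ∈ S, crNorm r (Metric.ball 0 ρ) (φ n) ≤ K := by
    lift (⨆ n ∈ S, crNorm r (Metric.ball 0 ρ) (φ n)) to NNReal using hφ_bdd.ne with K hK
    exact ⟨K, fun n hn => hK ▸ le_iSup₂_of_le n hn le_rfl⟩
  set F : Filter ℕ := atTop ⊓ 𝓟 S with hF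
  have hFatTop : F ≤ atTop := inf_le_left
  have hFS : ∀ᶠ n in F, n ∈ S := mem_inf_of_right (mem_principal_self S)
  have hFne : F.NeBot := Filter.frequently_mem_iff_neBot.1
    (Nat.frequently_atTop_iff_infinite.2 hS)
  have hCN : ∀ n, ContDiffOn ℝ N (φ n) (Metric.ball 0 ρ) := fun n =>
    (hφ n).1.of_le (by exact_mod_cast hNfloor)
  have hjet : JetConjugacy wV wW f g φ ε C K a L (eta 0) q (d1 lam + 1) (d3 eta + 1) N F :=
    { eps_pos := hε0
      cocycleV := hcV
      cocycleW := hcW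
      boundsV := hBV
      boundsW := hBW
      one_lt := by omega
      largeV := by linarith
      largeW := by linarith
      -- `s ≤ N + 1` and `q + 3 ε < 0`, so that `(N + 1) (q + 3 ε) ≤ s (q + 3 ε) < a - 2 ε`.
      degree := by nlinarith
      lower := hf_lower
      le_atTop := hFatTop
      bounded := hFS.mono fun n hn k hk =>
        norm_polarization_le_of_crNorm_le hρ (hK n hn) (hk.trans hNfloor)
      conj := Eventually.of_forall fun n => isLittleO_taylorPoly_conj hρ (hCN 0) (hCN n)
        (hcV.analyticAt_iterComp n _).hasStrictFDerivAt
        (hcW.analyticAt_iterComp n 0).differentiableAt (hcW.iterComp_zero n) (hφ_eq n) }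
  -- The gaps between weights of `V` and sums of at most `N` weights of `W` exceed `2 N ε`.
  have hgap : ∀ {ι : Type} [Fintype ι] (b : ι → ℝ), (∀ i, b i ∈ Set.range eta) →
      ∀ β : ι → ℕ, β ≠ 0 → mdeg β ≤ N → ∀ v : V 0, v ≠ 0 →
        mweight b β < (wV 0).val v → mweight b β + 2 * N * ε < (wV 0).val v := by
    intro ι _ b hb β hβ hβN v hv hlt
    choose J hJ using hb
    obtain ⟨i, hi⟩ := hV_values 0 ▸ (wV 0).val_mem_values hv
    obtain ⟨σ, hσ⟩ := exists_word_mweight β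
    have hsum : ∑ m, eta (J (σ m)) = mweight b β := by
      rw [← hσ b]
      exact Finset.sum_congr rfl fun m _ => hJ _
    have h1 := hε.lt_gap i (mdeg β) (fun m => J (σ m))
      (Nat.one_le_iff_ne_zero.2 (mdeg_eq_zero.not.2 hβ)) hβN (by rw [hsum, hi]; linarith)
    rw [hsum, hi] at h1
    nlinarith
  refine ⟨taylorPoly (φ 0) N, isSubresonant_taylorPoly fun k hk v hv => ?_, fun x hx => ?_⟩
  · have hb : ∀ i, (wW 0).val (v i) ∈ Set.range eta := fun i =>
      hW_values 0 ▸ (wW 0).val_mem_values (hv i)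
    rcases Nat.eq_zero_or_pos k with rfl | hk0
    · refine (wV 0).le_mono ?_ ((wV 0).mem_le_of_values_le _ (hBV.le 0))
      simpa using hlam_neg.le
    · have h1 := hjet.jetCoeff_mem_le (fun i => (wW 0).mem_le_val (v i)) (hgap _ hb) (fun _ => 1)
        fun h0 => one_ne_zero (congrFun h0 ⟨0, hk0⟩)
      simpa [mweight] using h1
  · -- A single variable, of the largest weight.
    have hxq : ∀ _ : Unit, x ∈ (wW 0).le q := fun _ => (wW 0).mem_le_of_values_le _ (hBW.le 0)
    have h1 := hjet.expSmall_iterComp_taylorPoly_sub (u := fun _ : Unit => x) hxq (fun _ => le_rfl)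
      (hjet.jetCoeff_mem_le hxq (hgap _ fun _ => ⟨Fin.last p, rfl⟩))
    simp only [Finset.univ_unique, Finset.sum_const, Finset.card_singleton, one_smul] at h1
    have hG := (hcW.expSmall_iterComp hε0 hBW (by linarith) x).mono hFatTop le_rfl hFatTop
    have hG1 : ∀ᶠ n in F, ‖iterComp g n x‖ ≤ Real.exp (q + 2 * ε) ^ n := by
      filter_upwards [Asymptotics.IsLittleO.bound hG one_pos] with n hn
      rwa [norm_norm, one_mul, Real.norm_of_nonneg (by positivity)] at hn
    have hG2 : ∀ᶠ n in F, iterComp g n x ∈ Metric.ball (0 : W n) ρ := by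
      have h2 : Tendsto (fun n : ℕ => Real.exp (q + 2 * ε) ^ n) F (𝓝 0) :=
        (tendsto_pow_atTop_nhds_zero_of_lt_one (Real.exp_pos _).le
          (by rw [← Real.exp_zero]; exact Real.exp_lt_exp.2 (by linarith))).mono_left hFatTop
      filter_upwards [hG1, h2.eventually (gt_mem_nhds hρ)] with n hn1 hn2
      simpa using hn1.trans_lt hn2
    have h3 : ExpSmall F (a - ε) fun n =>
        φ n (iterComp g n x) - taylorPoly (φ n) N (iterComp g n x) := by
      refine (ExpBounded.of_le (x := s * (q + 2 * ε)) K ?_).expSmall hFatTop (by nlinarith)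
      filter_upwards [hG1, hG2, hFS] with n hn1 hn2 hnS
      refine (norm_sub_taylorPoly_le_of_crNorm_le hNr (hφ n) (hK n hnS) hn2).trans ?_
      have h4 : Real.exp (s * (q + 2 * ε)) ^ n = (Real.exp (q + 2 * ε) ^ n) ^ s := by
        rw [← Real.exp_nat_mul, ← Real.exp_nat_mul, ← Real.exp_mul]
        ring_nf
      rw [h4]
      gcongr
      exact Real.rpow_le_rpow (norm_nonneg _) hn1 hs0.le
    refine hcV.eq_of_expSmall_iterComp_sub hε0 hBV (by omega) (by linarith) hf_lower hFatTop ?_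
    refine Asymptotics.IsLittleO.congr' (h3.sub h1) ?_ EventuallyEq.rfl
    filter_upwards [hG2] with n hn
    rw [hφ_eq n x hx hn]
    congr 1
    abel
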